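/- Let $n\ge 1$, let $M_{2n}$ be the algebra of complex $2n\times 2n$ matrices and let $M_{2n}^{+}\subset M_{2n}$ be the space of symmetric matrices. For an associative complex algebra $R$, identify $\bigwedge^k (M_{2n}^+)^*\otimes R$ with the alternating $k$-linear maps $(M_{2n}^+)^k\to R$, with product $$(G\wedge H)(v_1,\dots,v_{h+k})=\frac1{h!\,k!}\sum_{\sigma\in S_{h+k}}\epsilon_\sigma\, G(v_{\sigma(1)},\dots,v_{\sigma(h)})\,H(v_{\sigma(h+1)},\dots,v_{\sigma(h+k)}).$$ Let $X\in (M_{2n}^+)^*\otimes M_{2n}$ be the inclusion $M_{2n}^+\to M_{2n}$, let $X^a$ be its $a$-th power for $\wedge$, and let $\mathrm{Tr}$ be the trace applied to values. For $Y_1,\dots,Y_n\in M_{2n}$ put $Z_i=\frac{Y_i-Y_i^t}{2}$ and let $$Q(Y_1,\dots,Y_n)=\frac1{2^n n!}\sum_{\sigma\in S_{2n}}\epsilon_\sigma\prod_{i=1}^n (Z_i)_{\sigma(2i-1),\sigma(2i)}$$ be the polarized pfaffian of $Z_1,\dots,Z_n$. Let $e_1,\dots,e_{2n}$ be the standard basis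 of $\mathbb C^{2n}$ and $e_i\wedge e_j=e_i\otimes e_j-e_j\otimes e_i$, a skew-symmetric matrix. Define $\Omega\in\bigwedge^{2n-2}(M_{2n}^+)^*\otimes M_{2n}$ by $$\Omega(X_1,\dots,X_{2n-2})=\sum_{i<j}\ \sum_{\sigma\in S_{2n-2}}\epsilon_\sigma\, Q\big([X_{\sigma(1)},X_{\sigma(2)}],\dots,[X_{\sigma(2n-3)},X_{\sigma(2n-2)}],e_i\wedge e_j\big)\; e_i\wedge e_j ,$$ and its relative differential $d\Omega\in\bigwedge^{2n-1}(M_{2n}^+)^*\otimes M_{2n}$ by $$d\Omega(X_1,\dots,X_{2n-1})=\sum_{i<j}(-1)^{i+j+1}\,\Omega([X_i,X_j],X_1,\dots,\hat X_i,\dots,\hat X_j,\dots,X_{2n-1})+\sum_{h}(-1)^h X_h\cdot\Omega(X_1,\dots,\hat X_h,\dots,X_{2n-1}),$$ where $X\cdot Y=XY+YX^t$, and where $[X_i,X_j]$ is taken modulo skew-symmetric matrices, that is, replaced by its symmetric part (so that the first sum vanishes; for $n=1$ it is absent). Then there are a rational number $q\ne 0$ and a homogeneous polynomial $R$ of degree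 $4n-3$ in the elements $\mathrm{Tr}(X^i)$ with $0<i<4n-3$ (that is, a complex linear combination of products $\mathrm{Tr}(X^{i_1})\wedge\dots\wedge\mathrm{Tr}(X^{i_r})$ with all $0<i_j<4n-3$ and $i_1+\dots+i_r=4n-3$) such that $$\mathrm{Tr}(\Omega\wedge d\Omega)=q\cdot \mathrm{Tr}(X^{4n-3})+R .$$ -/

import Mathlib

open scoped Nat

namespace EvenOrthogonal

noncomputable section

/-- Complex `2n × 2n` matrices. -/
abbrev Mat (n : ℕ) : Type := Matrix (Fin (2 * n)) (Fin (2 * n)) ℂ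

/-- The space `M_{2n}^+` of symmetric complex `2n × 2n` matrices. -/
def symMat (n : ℕ) : Submodule ℂ (Mat n) where
  carrier := {A | A.transpose = A}
  add_mem' := by
    intro A B hA hB
    simp only [Set.mem_ofPred_eq] at *
    rw [Matrix.transpose_add, hA, hB]
  zero_mem' := by simp
  smul_mem' := by
    intro c A hA
    simp only [Set.mem_ofPred_eq] at *
    rw [Matrix.transpose_smul, hA]

/-- The symmetric part `(A + Aᵗ)/2` of a matrix. It identifies the quotient of all matrices by the
skew-symmetric ones (that is, `gl(2n)/so(2n)`) with `M_{2n}^+`. -/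
def symPart {n : ℕ} (A : Mat n) : symMat n :=
  ⟨(1 / 2 : ℂ) • (A + A.transpose), by
    change ((1 / 2 : ℂ) • (A + A.transpose)).transpose = _
    rw [Matrix.transpose_smul, Matrix.transpose_add, Matrix.transpose_transpose, add_comm]⟩

/-- Functions of `k` symmetric matrices with values in `R`. All the functions used below
are multilinear and alternating, i.e. elements of `⋀^k (M_{2n}^+)^* ⊗ R`. -/
abbrev Form (n k : ℕ) (R : Type) : Type := (Fin k → symMat n) → R

/-- The product of alternating multilinear maps with values in an algebra `R`:
`(G ∧ H)(v₁,…,v_{h+k}) = 1/(h! k!) ∑_σ ε_σ G(v_{σ 1},…,v_{σ h}) H(v_{σ(h+1)},…,v_{σ(h+k)})`. -/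
def wedge {n h k : ℕ} {R : Type} [Ring R] [Algebra ℂ R] (G : Form n h R) (H : Form n k R) :
    Form n (h + k) R := fun v =>
  (1 / ((h ! : ℂ) * (k ! : ℂ))) •
    ∑ σ : Equiv.Perm (Fin (h + k)), ((Equiv.Perm.sign σ : ℤ) : ℂ) •
      (G (fun i => v (σ (Fin.castAdd k i))) * H (fun i => v (σ (Fin.natAdd h i))))

/-- A form of degree `a` regarded as a form of degree `b`, where `a = b`. -/
def castDeg {n a b : ℕ} {R : Type} (e : a = b) (G : Form n a R) : Form n b R :=
  fun v => G (fun i => v (Fin.cast e i))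

/-- The trace of a matrix valued form. -/
def trForm {n k : ℕ} (G : Form n k (Mat n)) : Form n k ℂ := fun v => (G v).trace

/-- The inclusion `X : M_{2n}^+ → M_{2n}` as a matrix valued form of degree one. -/
def inclX (n : ℕ) : Form n 1 (Mat n) := fun v => (v 0 : Mat n)

/-- The power `X^k = X ∧ ⋯ ∧ X`. -/
def powX (n : ℕ) : (k : ℕ) → Form n k (Mat n)
  | 0 => fun _ => 1
  | k + 1 => wedge (powX n k) (inclX n)

/-- The monomial `Tr(X^{i₁}) ∧ ⋯ ∧ Tr(X^{i_r})` attached to the list `[i₁, …, i_r]`. -/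
def traceMonomial (n : ℕ) : (l : List ℕ) → Form n l.sum ℂ
  | [] => fun _ => 1
  | i :: l => wedge (trForm (powX n i)) (traceMonomial n l)

/-- The homogeneous polynomials of degree `d` in the elements `Tr(X^i)` with `i < m`:
the linear combinations of the monomials `Tr(X^{i₁}) ∧ ⋯ ∧ Tr(X^{i_r})` with all `0 < i_j < m` and
`i₁ + ⋯ + i_r = d`. -/
def tracePolynomials (n m d : ℕ) : Submodule ℂ (Form n d ℂ) :=
  Submodule.span ℂ {f | ∃ (l : List ℕ) (e : l.sum = d),
    (∀ i ∈ l, 0 < i ∧ i < m) ∧ f = castDeg e (traceMonomial n l)}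

/-- The polarized pfaffian of `n` skew-symmetric matrices of size `2n`:
`1/(2^n n!) ∑_σ ε_σ ∏_i (Y_i)_{σ(2i-1), σ(2i)}`. -/
def pfaffianPolar {n : ℕ} (Y : Fin n → Mat n) : ℂ :=
  (1 / ((2 : ℂ) ^ n * (n ! : ℂ))) *
    ∑ σ : Equiv.Perm (Fin (2 * n)), ((Equiv.Perm.sign σ : ℤ) : ℂ) *
      ∏ i : Fin n, Y i (σ ⟨2 * i.val, by omega⟩) (σ ⟨2 * i.val + 1, by omega⟩)

/-- `Q(Y₁,…,Y_n)`: the polarized pfaffian of the skew-symmetric parts `(Y_i - Y_iᵗ)/2`. -/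
def Q {n : ℕ} (Y : Fin n → Mat n) : ℂ :=
  pfaffianPolar (fun i => (1 / 2 : ℂ) • (Y i - (Y i).transpose))

/-- `e_i ∧ e_j = e_i ⊗ e_j - e_j ⊗ e_i` as a skew-symmetric matrix. -/
def wedgeE {n : ℕ} (i j : Fin (2 * n)) : Mat n :=
  Matrix.single i j 1 - Matrix.single j i 1

/-- `Q([X₁,X₂],…,[X_{2n-3},X_{2n-2}],E)`. -/
def commQ {n : ℕ} (X : Fin (2 * n - 2) → symMat n) (E : Mat n) : ℂ :=
  Q (fun k : Fin n =>
    if hk : k.val + 1 < n then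
      ⁅(X ⟨2 * k.val, by omega⟩ : Mat n), (X ⟨2 * k.val + 1, by omega⟩ : Mat n)⁆
    else E)

/-- The covariant `Ω(X₁,…,X_{2n-2})
= ∑_{i<j} ∑_σ ε_σ Q([X_{σ 1},X_{σ 2}],…,[X_{σ(2n-3)},X_{σ(2n-2)}], e_i ∧ e_j) e_i ∧ e_j`. -/
def Omega (n : ℕ) : Form n (2 * n - 2) (Mat n) := fun X =>
  ∑ i : Fin (2 * n), ∑ j : Fin (2 * n), if i < j then
    ∑ σ : Equiv.Perm (Fin (2 * n - 2)),
      (((Equiv.Perm.sign σ : ℤ) : ℂ) * commQ (fun a => X (σ a)) (wedgeE i j)) • wedgeE i j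
  else 0

/-- The bracket part of the relative differential,
`∑_{i<j} (-1)^{i+j+1} ω([X_i,X_j], X₁,…,X̂_i,…,X̂_j,…)`, the class of `[X_i,X_j]`
modulo skew-symmetric matrices being represented by its symmetric part. With indices starting
from `0`, as here, the sign is the same. For `ω` of degree `0` there are no such terms. -/
def bracketPart {n : ℕ} : {k : ℕ} → Form n k (Mat n) → Form n (k + 1) (Mat n)
  | 0, _ => fun _ => 0
  | _ + 1, ω => fun X =>
      ∑ j, ∑ i, if Fin.castSucc i < j then
        (-1 : ℂ) ^ (i.val + j.val + 1) •
          ω (Fin.cons (symPart ⁅(X (Fin.castSucc i) : Mat n), (X j : Mat n)⁆)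
            (Fin.removeNth i (Fin.removeNth j X)))
      else 0

/-- The action `X · Y = X Y + Y Xᵗ`. -/
def act {n : ℕ} (X Y : Mat n) : Mat n := X * Y + Y * X.transpose

/-- The relative differential
`dω(X₁,…,X_{k+1}) = ∑_{i<j} (-1)^{i+j+1} ω([X_i,X_j], X₁,…,X̂_i,…,X̂_j,…,X_{k+1})
  + ∑_h (-1)^h X_h · ω(X₁,…,X̂_h,…,X_{k+1})`.
The indices `i`, `j`, `h` start from `1` in this formula and from `0` in the code. -/
def relDiff {n k : ℕ} (ω : Form n k (Mat n)) : Form n (k + 1) (Mat n) := fun X =>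
  bracketPart ω X +
    ∑ h : Fin (k + 1), (-1 : ℂ) ^ (h.val + 1) • act (X h : Mat n) (ω (Fin.removeNth h X))

end

end EvenOrthogonal

/-!
The proof evaluates all forms at a generic odd symmetric matrix. Given symmetric matrices
`w_1, …, w_m`, a form `G` of degree `k` is pulled back to the element
`1 / k! ∑ G(w_{f 1}, …, w_{f k}) θ_{f 1} ⋯ θ_{f k}` of the Grassmann algebra on `θ_1, …, θ_m` (`hat`,
and `hatMat` for matrix valued forms). The pullback turns wedge products into products
(`hat_wedge`, `hatMat_wedge`), and an alternating form of degree `m` is determined by its pullbacks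
(`eq_of_hat_eq`). Under the pullback, `X` becomes the symmetric matrix `x = ∑ θ_a w_a` with
anticommuting entries.

The matrix `Y = x ^ 2` is skew-symmetric with central entries (`sqX`), and the pullback of `Ω` is a
multiple of its Pfaffian adjugate `P` (`hatMat_Omega`), the matrix of partial derivatives of the
Pfaffian at `Y`. Since the entries of `P` are central and the bracket part of `dΩ` vanishes, `dΩ`
becomes `-(x P + P x)` up to the same factor, and `Tr(Ω ∧ dΩ)` becomes a multiple of `-2 Tr(P ^ 2 x)`
(`hat_trForm_Omega_wedge_relDiff`).

For an invertible skew-symmetric matrix `Y` over a commutative ring, `P` is proportional to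
`Pf(Y) Y⁻¹` and `Pf(Y) ^ 2 = det Y`, so by the Cayley-Hamilton theorem `P ^ 2` is a multiple of
`Y ^ (2n - 2) + c_2 Y ^ (2n - 4) + ⋯ + c_{2n - 2}`, with `c_i` the coefficients of the characteristic
polynomial of `Y`; the identity extends to all skew-symmetric `Y` when the additive group of the
ring is torsion-free (`pfAdj_sq`). The coefficients `c_i` are polynomials in the traces of the powers
`Y ^ k = x ^ (2k)`, which vanish because the entries of `x` anticommute (`trace_sqX_pow`). Hence
`P ^ 2` is a nonzero multiple of `-x ^ (4n - 4)`, and `Tr(Ω ∧ dΩ)` is a nonzero multiple of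
`Tr(X ^ (4n - 3))`: the decomposable remainder can be taken to be zero.
-/

namespace EvenOrthogonal

noncomputable section

/-! ### Pfaffians over a commutative ring -/

section Pfaffian

open Matrix Equiv Polynomial

variable {κ ι R S : Type*} [Fintype κ] [Fintype ι] [DecidableEq ι] [CommRing R] [CommRing S]

/-- The polarized Pfaffian, without the factor `1 / (2 ^ n * n!)`, of a family of matrices. The index
set `ι` is cut into pairs by `e`: the pair labelled `k` is `e (k, 0), e (k, 1)`. -/
def pfPolar (e : κ × Fin 2 ≃ ι) (Y : κ → Matrix ι ι R) : R :=
  ∑ σ : Perm ι, (Perm.sign σ : ℤ) • ∏ k, Y k (σ (e (k, 0))) (σ (e (k, 1)))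

/-- The Pfaffian of `Y`, multiplied by `2 ^ n * n!` where `n` is the number of pairs. -/
def pfSum (e : κ × Fin 2 ≃ ι) (Y : Matrix ι ι R) : R := pfPolar e fun _ => Y

/-- The polarized Pfaffian with `E` in the slot `k₀` and `Y` in all the others. It does not depend on
`k₀`, and `n` times it is the derivative of `pfSum e` at `Y` in the direction `E`. -/
def pfDeriv [DecidableEq κ] (e : κ × Fin 2 ≃ ι) (k₀ : κ) (Y E : Matrix ι ι R) : R :=
  pfPolar e (Function.update (fun _ => Y) k₀ E)

/-- The Pfaffian adjugate of `Y`: the matrix of coefficients of the linear form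
`E ↦ pfDeriv e k₀ Y E`. -/
def pfAdj [DecidableEq κ] (e : κ × Fin 2 ≃ ι) (k₀ : κ) (Y : Matrix ι ι R) : Matrix ι ι R :=
  of fun i j => pfDeriv e k₀ Y (single i j 1)

lemma map_pfPolar (f : R →+* S) (e : κ × Fin 2 ≃ ι) (Y : κ → Matrix ι ι R) :
    f (pfPolar e Y) = pfPolar e fun k => (Y k).map f := by
  simp [pfPolar, map_sum, map_prod]

lemma map_pfSum (f : R →+* S) (e : κ × Fin 2 ≃ ι) (Y : Matrix ι ι R) :
    f (pfSum e Y) = pfSum e (Y.map f) := map_pfPolar ..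

variable [DecidableEq κ]

lemma map_pfDeriv (f : R →+* S) (e : κ × Fin 2 ≃ ι) (k₀ : κ) (Y E : Matrix ι ι R) :
    f (pfDeriv e k₀ Y E) = pfDeriv e k₀ (Y.map f) (E.map f) := by
  rw [pfDeriv, map_pfPolar, pfDeriv]
  congr 1
  ext k : 1
  rcases eq_or_ne k k₀ with rfl | h <;> simp [*]

lemma pfAdj_map (f : R →+* S) (e : κ × Fin 2 ≃ ι) (k₀ : κ) (Y : Matrix ι ι R) :
    pfAdj e k₀ (Y.map f) = (pfAdj e k₀ Y).map f := by
  ext i j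
  simp [pfAdj, map_pfDeriv, Matrix.map_single]

lemma pfDeriv_eq_sum (e : κ × Fin 2 ≃ ι) (k₀ : κ) (Y E : Matrix ι ι R) :
    pfDeriv e k₀ Y E = ∑ σ : Perm ι, (Perm.sign σ : ℤ) •
      (E (σ (e (k₀, 0))) (σ (e (k₀, 1))) *
        ∏ k ∈ Finset.univ.erase k₀, Y (σ (e (k, 0))) (σ (e (k, 1)))) := by
  refine Finset.sum_congr rfl fun σ _ => ?_
  rw [← Finset.mul_prod_erase Finset.univ _ (Finset.mem_univ k₀), Function.update_self]
  congr 2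
  refine Finset.prod_congr rfl fun k hk => ?_
  rw [Function.update_of_ne (Finset.ne_of_mem_erase hk)]

lemma pfDeriv_eq_sum_pfAdj (e : κ × Fin 2 ≃ ι) (k₀ : κ) (Y E : Matrix ι ι R) :
    pfDeriv e k₀ Y E = ∑ i, ∑ j, E i j * pfAdj e k₀ Y i j := by
  simp only [pfAdj, of_apply, pfDeriv_eq_sum, Finset.mul_sum, mul_smul_comm]
  rw [Finset.sum_congr rfl fun i _ => Finset.sum_comm, Finset.sum_comm]
  refine Finset.sum_congr rfl fun σ _ => ?_
  simp only [single_apply, ite_mul, one_mul, zero_mul, mul_ite, mul_zero, smul_ite, smul_zero]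
  rw [Finset.sum_eq_single (σ (e (k₀, 0))), Finset.sum_eq_single (σ (e (k₀, 1)))]
  · simp
  · intro j _ hj; simp [hj]
  · simp
  · intro i _ hi; simp [hi]
  · simp

lemma pfDeriv_transpose (e : κ × Fin 2 ≃ ι) (k₀ : κ) (Y E : Matrix ι ι R) :
    pfDeriv e k₀ Y Eᵀ = -pfDeriv e k₀ Y E := by
  have hne : e (k₀, 0) ≠ e (k₀, 1) := by simp
  rw [pfDeriv_eq_sum, pfDeriv_eq_sum, ← Finset.sum_neg_distrib,
    ← Equiv.sum_comp (Equiv.mulRight (swap (e (k₀, 0)) (e (k₀, 1))))]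
  refine Finset.sum_congr rfl fun σ _ => ?_
  have : ∀ k ∈ Finset.univ.erase k₀, ∀ s,
      swap (e (k₀, 0)) (e (k₀, 1)) (e (k, s)) = e (k, s) := by
    intro k hk s
    apply swap_apply_of_ne_of_ne <;> simp [Finset.ne_of_mem_erase hk]
  simp only [coe_mulRight, Perm.sign_mul, Perm.sign_swap hne, Perm.mul_apply, swap_apply_left,
    swap_apply_right, transpose_apply]
  rw [Finset.prod_congr rfl fun k hk => by rw [this k hk 0, this k hk 1]]
  simp

lemma pfDeriv_sub_transpose (e : κ × Fin 2 ≃ ι) (k₀ : κ) (Y E : Matrix ι ι R) :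
    pfDeriv e k₀ Y (E - Eᵀ) = 2 * pfDeriv e k₀ Y E := by
  have h : pfDeriv e k₀ Y (E - Eᵀ) = pfDeriv e k₀ Y E - pfDeriv e k₀ Y Eᵀ := by
    simp only [pfDeriv_eq_sum_pfAdj, Matrix.sub_apply, sub_mul, Finset.sum_sub_distrib]
  rw [h, pfDeriv_transpose]
  ring

lemma pfAdj_transpose (e : κ × Fin 2 ≃ ι) (k₀ : κ) (Y : Matrix ι ι R) :
    (pfAdj e k₀ Y)ᵀ = -pfAdj e k₀ Y := by
  ext i j
  simp only [pfAdj, transpose_apply, of_apply, Matrix.neg_apply]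
  rw [← transpose_single, pfDeriv_transpose]

/-- Permuting the slots moves whole pairs of indices, which is an even permutation. -/
lemma pfPolar_comp_perm (e : κ × Fin 2 ≃ ι) (Y : κ → Matrix ι ι R) (π : Perm κ) :
    pfPolar e (fun k => Y (π k)) = pfPolar e Y := by
  set τ : Perm ι := e.permCongr (prodCongrLeft fun _ => π) with hτ
  have hs : Perm.sign τ = 1 := by
    rw [hτ, Perm.sign_permCongr, Perm.sign_prodCongrLeft]
    simp
  have hτe : ∀ k s, τ (e (k, s)) = e (π k, s) := by
    intro k s; simp [hτ, prodCongrLeft]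
  unfold pfPolar
  rw [← Equiv.sum_comp (Equiv.mulRight τ)]
  refine Finset.sum_congr rfl fun σ _ => ?_
  simp only [coe_mulRight, Perm.sign_mul, hs, mul_one, Perm.mul_apply, hτe]
  congr 1
  exact Equiv.prod_comp π fun k => Y k (σ (e (k, 0))) (σ (e (k, 1)))

lemma pfDeriv_congr_slot (e : κ × Fin 2 ≃ ι) (k k' : κ) (Y E : Matrix ι ι R) :
    pfDeriv e k Y E = pfDeriv e k' Y E := by
  rw [pfDeriv, pfDeriv, ← pfPolar_comp_perm e _ (swap k k')]
  congr 1
  ext l : 1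
  simp only [Function.update_apply]
  congr 1
  simp [Equiv.swap_apply_eq_iff]

/-- A sum over all self-maps of a finite type whose terms vanish at non-bijective maps is a sum over
permutations. -/
lemma _root_.Fintype.sum_eq_sum_perm {N : Type*} [AddCommMonoid N] {F : (ι → ι) → N}
    (h : ∀ f, ¬ Function.Bijective f → F f = 0) : ∑ f, F f = ∑ σ : Perm ι, F σ := by
  classical
  rw [← Finset.sum_subset (Finset.subset_univ (Finset.univ.filter Function.Bijective))
    fun f _ hf => h f (by simpa using hf)]
  refine (Finset.sum_bij (fun (σ : Perm ι) _ => (σ : ι → ι)) (by simp)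
    (fun _ _ _ _ h => DFunLike.coe_injective h)
    (fun f hf => ⟨Equiv.ofBijective f (by simpa using hf), Finset.mem_univ _, rfl⟩)
    fun _ _ => rfl).symm

lemma pfSum_congruence (e : κ × Fin 2 ≃ ι) (B Y : Matrix ι ι R) :
    pfSum e (B * Y * Bᵀ) = B.det * pfSum e Y := by
  -- Expanding the products, as in the proof of the multiplicativity of the determinant.
  have key : ∀ σ : Perm ι, ∏ k, (B * Y * Bᵀ) (σ (e (k, 0))) (σ (e (k, 1))) =
      ∑ f : ι → ι, (∏ i, B (σ i) (f i)) * ∏ k, Y (f (e (k, 0))) (f (e (k, 1))) := by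
    intro σ
    have h1 : ∀ a b, (B * Y * Bᵀ) a b = ∑ p : Fin 2 → ι, B a (p 0) * B b (p 1) * Y (p 0) (p 1) := by
      intro a b
      rw [← (finTwoArrowEquiv ι).symm.sum_comp, Fintype.sum_prod_type_right]
      simp only [mul_apply, transpose_apply, Finset.sum_mul]
      refine Finset.sum_congr rfl fun i _ => Finset.sum_congr rfl fun j _ => ?_
      simp [finTwoArrowEquiv]; ring
    simp only [h1]
    rw [Finset.prod_univ_sum, Fintype.piFinset_univ,
      ← ((Equiv.curry κ (Fin 2) ι).symm.trans (e.arrowCongr (Equiv.refl ι))).sum_comp]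
    refine Finset.sum_congr rfl fun f _ => ?_
    rw [Finset.prod_mul_distrib, ← e.prod_comp, Fintype.prod_prod_type]
    simp [Fin.prod_univ_two, Equiv.arrowCongr]
  unfold pfSum pfPolar
  simp only [key, Finset.smul_sum]
  rw [Finset.sum_comm]
  have h2 : ∀ f : ι → ι, ∑ σ : Perm ι, (Perm.sign σ : ℤ) •
      ((∏ i, B (σ i) (f i)) * ∏ k, Y (f (e (k, 0))) (f (e (k, 1)))) =
      (B.submatrix id f).det * ∏ k, Y (f (e (k, 0))) (f (e (k, 1))) := by
    intro f
    rw [det_apply, Finset.sum_mul]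
    simp [Units.smul_def, mul_assoc]
  simp only [h2]
  rw [Fintype.sum_eq_sum_perm fun f hf => ?_, Finset.mul_sum]
  · refine Finset.sum_congr rfl fun σ _ => ?_
    rw [det_permute', zsmul_eq_mul]; ring
  · have : ¬ Function.Injective f := fun h => hf (Finite.injective_iff_bijective.1 h)
    simp only [Function.Injective, not_forall] at this
    obtain ⟨a, b, hab, hne⟩ := this
    rw [det_zero_of_column_eq hne fun i => by simp [hab], zero_mul]

lemma derivative_pfSum (e : κ × Fin 2 ≃ ι) (k₀ : κ) (Y : Matrix ι ι R[X]) :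
    derivative (pfSum e Y) = Fintype.card κ • pfDeriv e k₀ Y (Y.map derivative) := by
  have h : derivative (pfSum e Y) = ∑ k, pfDeriv e k Y (Y.map derivative) := by
    simp only [pfSum, pfPolar, derivative_sum, derivative_smul, derivative_prod_finset,
      pfDeriv_eq_sum, map_apply]
    rw [Finset.sum_comm]
    refine Finset.sum_congr rfl fun σ _ => ?_
    rw [Finset.smul_sum]
    exact Finset.sum_congr rfl fun k _ => by rw [mul_comm]
  rw [h, Finset.sum_congr rfl fun k _ => pfDeriv_congr_slot e k k₀ Y _]
  simp

/-- Jacobi's formula. -/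
lemma derivative_det (A : Matrix ι ι R[X]) :
    derivative A.det = (A.adjugate * A.map derivative).trace := by
  have h : (A.adjugate * A.map derivative).trace =
      ∑ i, (A.updateCol i fun k => derivative (A k i)).det := by
    refine Finset.sum_congr rfl fun i _ => ?_
    rw [← cramer_apply, cramer_eq_adjugate_mulVec]
    rfl
  rw [h, det_apply, derivative_sum]
  simp only [det_apply, Units.smul_def, derivative_smul, derivative_prod_finset, Finset.smul_sum]
  rw [Finset.sum_comm]
  refine Finset.sum_congr rfl fun i _ => Finset.sum_congr rfl fun σ _ => ?_
  rw [← Finset.mul_prod_erase Finset.univ _ (Finset.mem_univ i), mul_comm]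
  congr 2
  · simp
  · refine Finset.prod_congr rfl fun k hk => ?_
    rw [updateCol_ne (Finset.ne_of_mem_erase hk)]

/-- The infinitesimal form of `pfSum_congruence`, obtained by differentiating it along
`B = 1 + X • M` at `X = 0`. -/
lemma pfDeriv_infinitesimal (e : κ × Fin 2 ≃ ι) (k₀ : κ) (Y M : Matrix ι ι R) :
    Fintype.card κ • pfDeriv e k₀ Y (M * Y + Y * Mᵀ) = M.trace * pfSum e Y := by
  set B : Matrix ι ι R[X] := 1 + (X : R[X]) • M.map C with hB
  have hev : ∀ A : Matrix ι ι R, (A.map C).map (evalRingHom 0) = A := by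
    intro A; ext i j; simp
  have hBe : B.map (evalRingHom 0) = 1 := by
    ext i j
    rcases eq_or_ne i j with rfl | h <;> simp [*]
  have hBd : B.map derivative = M.map C := by
    ext i j : 2
    rcases eq_or_ne i j with rfl | h <;> simp [*]
  have hmap : ∀ A A' : Matrix ι ι R[X],
      (A * A').map derivative = A.map derivative * A' + A * A'.map derivative := by
    intro A A'
    ext i j : 2
    simp [mul_apply, Finset.sum_add_distrib]
  have hC : (Y.map C).map derivative = 0 := by ext i j : 2; simp
  have h := congrArg (fun p : R[X] => evalRingHom 0 (derivative p))
    (pfSum_congruence e B (Y.map C))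
  simp only [← map_pfSum C] at h
  simp only [derivative_pfSum e k₀, derivative_mul, derivative_C, map_mul, map_nsmul,
    mul_zero, add_zero] at h
  have hd : evalRingHom 0 (derivative B.det) = M.trace := derivative_det_one_add_X_smul M
  rw [map_pfDeriv, hd, hmap, hmap, hC, transpose_map, hBd] at h
  have hevC : ∀ x : R, evalRingHom 0 (C x) = x := fun x => eval_C
  simpa only [Matrix.map_mul, Matrix.map_add _ (map_add (evalRingHom (0 : R))), transpose_map, hev,
    hBe, hevC, one_mul, mul_one, mul_zero, add_zero, transpose_one] using h

/-- The Laplace expansion of the Pfaffian: up to a constant, `pfAdj e k₀ Y` is the product of the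
Pfaffian of `Y` with the inverse of `Y`. This is `pfDeriv_infinitesimal` for the elementary
matrices. -/
lemma pfAdj_mul_self (e : κ × Fin 2 ≃ ι) (k₀ : κ) {Y : Matrix ι ι R} (hY : Yᵀ = -Y) :
    (2 * Fintype.card κ : R) • (pfAdj e k₀ Y * Y) = -pfSum e Y • (1 : Matrix ι ι R) := by
  ext b a
  have h := pfDeriv_infinitesimal e k₀ Y (single b a 1)
  have h1 : single b a 1 * Y + Y * (single b a 1)ᵀ =
      single b a 1 * Y - (single b a 1 * Y)ᵀ := by
    rw [transpose_mul, hY]; simp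
  rw [h1, pfDeriv_sub_transpose, pfDeriv_eq_sum_pfAdj] at h
  have h3 : ∑ i, ∑ j, (single b a (1 : R) * Y : Matrix ι ι R) i j * pfAdj e k₀ Y i j =
      (pfAdj e k₀ Y * Yᵀ) b a := by
    rw [Finset.sum_eq_single b, mul_apply]
    · simp [mul_comm]
    · intro i _ hi; simp [hi]
    · simp
  rw [h3, hY, mul_neg, Matrix.neg_apply, nsmul_eq_mul] at h
  have h4 : (single b a (1 : R)).trace = (1 : Matrix ι ι R) b a := by
    rcases eq_or_ne b a with rfl | hne
    · simp
    · simp [hne, trace_single_eq_of_ne]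
  rw [h4] at h
  rw [Matrix.smul_apply, Matrix.smul_apply, smul_eq_mul, smul_eq_mul]
  linear_combination -h

/-- Uniqueness for the differential equation `w' g = w g'`, by comparing coefficients: the solution
`w` is determined by its constant coefficient when that of `g` is not a zero divisor. -/
lemma eq_zero_of_derivative_mul_eq [IsAddTorsionFree R] {w g : R[X]}
    (h : derivative w * g = w * derivative g) (hw : w.coeff 0 = 0)
    (hg : g.coeff 0 ∈ nonZeroDivisors R) : w = 0 := by
  have key : ∀ n, ∀ m < n, w.coeff m = 0 := by
    intro n
    induction n with
    | zero => simp
    | succ n ih =>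
      intro m hm
      rcases Nat.lt_succ_iff_lt_or_eq.1 hm with hm | rfl
      · exact ih m hm
      cases m with
      | zero => exact hw
      | succ m =>
        have h1 := congrArg (coeff · m) h
        simp only [coeff_mul] at h1
        rw [Finset.sum_eq_single (m, 0),
          Finset.sum_eq_zero (s := Finset.HasAntidiagonal.antidiagonal m)] at h1
        · rw [coeff_derivative] at h1
          have h2 := (mem_nonZeroDivisors_iff_right.1 hg) _ h1
          have h3 : (m + 1) • w.coeff (m + 1) = 0 := by
            rw [nsmul_eq_mul, mul_comm]; exact_mod_cast h2
          exact (nsmul_eq_zero_iff_right (by omega)).1 h3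
        · rintro ⟨i, j⟩ hij
          simp only [Finset.HasAntidiagonal.mem_antidiagonal] at hij
          rw [ih i (by omega), zero_mul]
        · rintro ⟨i, j⟩ hij hne
          simp only [Finset.HasAntidiagonal.mem_antidiagonal] at hij
          have : i ≠ m := by
            rintro rfl; apply hne; simp; omega
          rw [coeff_derivative, ih (i + 1) (by omega), zero_mul, zero_mul]
        · simp
  ext n
  exact key (n + 1) n n.lt_succ_self

/-- The block diagonal skew-symmetric matrix with a block `!![0, 1; -1, 0]` on each pair of
indices. -/
def stdSkew (e : κ × Fin 2 ≃ ι) : Matrix ι ι ℤ := of fun i j =>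
  if (e.symm i).1 = (e.symm j).1 then ((e.symm j).2 : ℤ) - ((e.symm i).2 : ℤ) else 0

lemma stdSkew_transpose {κ ι : Type*} [DecidableEq κ] (e : κ × Fin 2 ≃ ι) :
    (stdSkew e)ᵀ = -stdSkew e := by
  ext i j
  simp only [stdSkew, transpose_apply, of_apply, Matrix.neg_apply, eq_comm]
  split_ifs <;> simp

/-- A permutation contributing to the Pfaffian of `stdSkew e` maps pairs to pairs; it is the product
of a permutation of the pairs, which is even, and of flips inside the pairs, whose signs are those of
the entries. So its contribution is `1`. -/
lemma stdSkew_term_nonneg (e : κ × Fin 2 ≃ ι) (σ : Perm ι) :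
    0 ≤ (Perm.sign σ : ℤ) • ∏ k, stdSkew e (σ (e (k, 0))) (σ (e (k, 1))) := by
  set ρ : Perm (κ × Fin 2) := e.symm.permCongr σ with hρ
  have hs : Perm.sign σ = Perm.sign ρ := (Perm.sign_permCongr _ _).symm
  have hJ : ∀ k, stdSkew e (σ (e (k, 0))) (σ (e (k, 1))) =
      if (ρ (k, 0)).1 = (ρ (k, 1)).1 then ((ρ (k, 1)).2 : ℤ) - ((ρ (k, 0)).2 : ℤ) else 0 := by
    intro k; simp [stdSkew, hρ]
  simp only [hJ, hs]
  by_cases hall : ∀ k, (ρ (k, 0)).1 = (ρ (k, 1)).1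
  · have h1 : ∀ k s, (ρ (k, s)).1 = (ρ (k, 0)).1 := by
      intro k s; fin_cases s <;> simp [hall]
    have ht : ∀ k, Function.Injective fun s => (ρ (k, s)).2 := by
      intro k s s' hss
      have : ρ (k, s) = ρ (k, s') := Prod.ext ((h1 k s).trans (h1 k s').symm) hss
      simpa using ρ.injective this
    let t : κ → Perm (Fin 2) := fun k => Equiv.ofBijective _ (Finite.injective_iff_bijective.1 (ht k))
    have hp : Function.Injective fun k => (ρ (k, 0)).1 := by
      intro k k' hkk
      obtain ⟨s, hs⟩ := (t k).surjective (ρ (k', 0)).2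
      have : ρ (k, s) = ρ (k', 0) := Prod.ext ((h1 k s).trans hkk) hs
      exact (Prod.ext_iff.1 (ρ.injective this)).1
    let π : Perm κ := Equiv.ofBijective _ (Finite.injective_iff_bijective.1 hp)
    have hρe : ρ = (prodCongrLeft fun _ => π) * prodCongrRight t := by
      ext ⟨k, s⟩ : 1
      exact Prod.ext (h1 k s) rfl
    have hsign : Perm.sign ρ = ∏ k, Perm.sign (t k) := by
      rw [hρe, Perm.sign_mul, Perm.sign_prodCongrLeft, Perm.sign_prodCongrRight]
      simp
    have ht2 : ∀ u : Perm (Fin 2), ((u 1 : ℕ) : ℤ) - ((u 0 : ℕ) : ℤ) = (Perm.sign u : ℤ) := by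
      decide
    have hprod : ∀ k, (if (ρ (k, 0)).1 = (ρ (k, 1)).1 then
        ((ρ (k, 1)).2 : ℤ) - ((ρ (k, 0)).2 : ℤ) else 0) = (Perm.sign (t k) : ℤ) := by
      intro k
      rw [if_pos (hall k)]
      exact ht2 (t k)
    simp only [hprod, hsign]
    rw [smul_eq_mul, Units.coe_prod]
    exact mul_self_nonneg _
  · obtain ⟨k, hk⟩ := not_forall.1 hall
    rw [Finset.prod_eq_zero (Finset.mem_univ k) (if_neg hk)]
    simp

lemma pfSum_stdSkew_pos (e : κ × Fin 2 ≃ ι) : 0 < pfSum e (stdSkew e) := by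
  refine Finset.sum_pos' (fun σ _ => stdSkew_term_nonneg e σ) ⟨1, Finset.mem_univ _, ?_⟩
  simp [stdSkew]

lemma _root_.Polynomial.isAddTorsionFree [IsAddTorsionFree R] : IsAddTorsionFree R[X] where
  nsmul_right_injective n hn p q h := by
    ext i
    have := congrArg (coeff · i) h
    simp only [coeff_smul] at this
    exact nsmul_right_injective hn this

/-- The characteristic polynomial of a skew-symmetric matrix of even size is even; in particular
its linear coefficient vanishes. -/
lemma charpoly_coeff_one_of_skew [IsAddTorsionFree R] {M : Matrix ι ι R} (hM : Mᵀ = -M)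
    (heven : Even (Fintype.card ι)) : M.charpoly.coeff 1 = 0 := by
  have h : M.charpoly.comp (-X) = M.charpoly := by
    conv_rhs => rw [← charpoly_transpose, hM]
    rw [charpoly, charpoly, ← coe_compRingHom_apply, RingHom.map_det]
    have : (compRingHom (-X)).mapMatrix (charmatrix M) = -charmatrix (-M) := by
      ext i j : 1
      rcases eq_or_ne i j with rfl | h
      · simp; ring
      · simp [h]
    rw [this, det_neg, heven.neg_one_pow, one_mul]
  have h1 := congrArg (fun p : R[X] => (derivative p).eval 0) h
  simp only [derivative_comp, derivative_neg, derivative_X, eval_mul, eval_comp, eval_neg, eval_X,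
    neg_zero, eval_one, ← coeff_zero_eq_eval_zero, coeff_derivative] at h1
  norm_num at h1
  have h2 : 2 • M.charpoly.coeff 1 = 0 := by rw [nsmul_eq_mul]; push_cast; linear_combination -h1
  exact (nsmul_eq_zero_iff_right two_ne_zero).1 h2

/-- For `A = 1 - X • M`, the traces of the powers of `M` are the coefficients of the logarithmic
derivative of `det A`, so `det A` is constant when they vanish. -/
lemma charpoly_eq_X_pow_of_trace_pow_eq_zero [IsAddTorsionFree R] {M : Matrix ι ι R}
    (hM : ∀ k, 0 < k → (M ^ k).trace = 0) : M.charpoly = X ^ Fintype.card ι := by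
  nontriviality R
  set A : Matrix ι ι R[X] := 1 - (X : R[X]) • M.map C with hA
  have hAdet : A.det = M.charpolyRev := rfl
  have htr : ∀ k, 0 < k → (((M.map C) ^ k : Matrix ι ι R[X])).trace = 0 := by
    intro k hk
    have : (M.map C) ^ k = (M ^ k).map C := (map_pow (C : R →+* R[X]).mapMatrix M k).symm
    rw [this, ← AddMonoidHom.map_trace C, hM k hk, map_zero]
  -- The geometric series for `A⁻¹`, multiplied by `det A`.
  have hgeom : ∀ N, A.adjugate = A.det • (∑ k ∈ Finset.range N, ((X : R[X]) • M.map C) ^ k) +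
      A.adjugate * ((X : R[X]) • M.map C) ^ N := by
    intro N
    have h := congrArg (A.adjugate * ·) (mul_neg_geom_sum ((X : R[X]) • M.map C) N)
    simp only [← mul_assoc] at h
    rw [← hA, adjugate_mul, smul_mul_assoc, one_mul, mul_sub, mul_one] at h
    rw [h, sub_add_cancel]
  -- The trace is divisible by every power of `X`.
  have hzero : (A.adjugate * M.map C).trace = 0 := by
    ext N
    rw [hgeom (N + 1), add_mul, trace_add, smul_mul_assoc, trace_smul, Finset.sum_mul, trace_sum,
      Finset.sum_eq_zero, smul_zero, zero_add, _root_.smul_pow, mul_smul_comm, smul_mul_assoc, trace_smul,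
      smul_eq_mul, coeff_X_pow_mul', if_neg (by omega), coeff_zero]
    intro k _
    rw [_root_.smul_pow, smul_mul_assoc, trace_smul, ← pow_succ, htr _ k.succ_pos, smul_zero]
  have hd : derivative A.det = 0 := by
    rw [derivative_det]
    have : A.map derivative = -M.map C := by
      ext i j : 2
      rcases eq_or_ne i j with rfl | h <;> simp [*]
    rw [this, mul_neg, trace_neg, hzero, neg_zero]
  have hrev : M.charpoly.reverse = 1 := by
    rw [reverse_charpoly, ← hAdet, eq_C_of_derivative_eq_zero hd, coeff_zero_eq_eval_zero, hAdet,
      eval_charpolyRev, C_1]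
  ext i
  rcases le_or_gt i (Fintype.card ι) with hi | hi
  · have := congrArg (coeff · (Fintype.card ι - i)) hrev
    simp only [coeff_reverse, charpoly_natDegree_eq_dim] at this
    rw [revAt_le (by omega), Nat.sub_sub_self hi] at this
    rw [this, coeff_one, coeff_X_pow]
    congr 1
    simp; omega
  · rw [coeff_eq_zero_of_natDegree_lt (by rwa [charpoly_natDegree_eq_dim]), coeff_X_pow,
      if_neg (by omega)]

lemma det_stdSkew_ne_zero (e : κ × Fin 2 ≃ ι) (k₀ : κ) : (stdSkew e).det ≠ 0 := by
  intro h0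
  have h := congrArg det (pfAdj_mul_self e k₀ (stdSkew_transpose e))
  rw [det_smul, det_smul, det_mul, h0, mul_zero, mul_zero, det_one, mul_one, eq_comm] at h
  have := pfSum_stdSkew_pos e
  have := eq_zero_of_pow_eq_zero h
  omega

/-- For a skew-symmetric matrix `Y`, with `p` its characteristic polynomial, the square of the
Pfaffian adjugate is a nonzero rational multiple of `q(Y)`, where `q` is `p` without its two terms of
lowest degree, divided by `X ^ 2`.

For invertible `Y` this follows from `pfAdj e k₀ Y ∼ Pf(Y) Y⁻¹`, from `Pf(Y) ^ 2 ∼ det Y`, and from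
the Cayley-Hamilton theorem `q(Y) Y ^ 2 + det Y = 0`. The general case is reduced to this one by
joining `Y` to the standard matrix `J` by the line `A = J + X • (Y - J)`, whose determinant is not a
zero divisor in `R[X]`. Along this line `Pf ^ 2` and `det` satisfy the same linear differential
equation, so they are proportional. -/
theorem pfAdj_sq [IsAddTorsionFree R] (e : κ × Fin 2 ≃ ι) (k₀ : κ) {Y : Matrix ι ι R}
    (hY : Yᵀ = -Y) :
    (((stdSkew e).det : R) * (2 * Fintype.card κ) ^ 2) • pfAdj e k₀ Y ^ 2 =
      -(((pfSum e (stdSkew e) : ℤ) : R) ^ 2) • aeval Y Y.charpoly.divX.divX := by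
  have := Polynomial.isAddTorsionFree (R := R)
  set N : R[X] := 2 * (Fintype.card κ : R[X]) with hN
  set J : Matrix ι ι R := (stdSkew e).map (Int.castRingHom R) with hJ
  have hJt : Jᵀ = -J := by
    rw [hJ, ← transpose_map, stdSkew_transpose]
    ext; simp
  set Z : Matrix ι ι R[X] := (Y - J).map C with hZ
  set A : Matrix ι ι R[X] := J.map C + (X : R[X]) • Z with hA
  have hAt : Aᵀ = -A := by
    ext i j : 1
    have h1 := congrFun (congrFun hJt i) j
    have h2 := congrFun (congrFun hY i) j
    simp only [transpose_apply, Matrix.neg_apply] at h1 h2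
    simp [hA, hZ, h1, h2]; ring
  have hA0 : A.map (evalRingHom 0) = J := by ext i j; simp [hA]
  have hA1 : A.map (evalRingHom 1) = Y := by ext i j; simp [hA, hZ]
  have hAd : A.map derivative = Z := by ext i j : 2; simp [hA, hZ]
  set c : R[X] := ((pfSum e (stdSkew e) : ℤ) : R[X]) with hc
  set d : R[X] := ((stdSkew e).det : R[X]) with hd
  set P := pfAdj e k₀ A with hP
  set f := pfSum e A with hf
  set g := A.det with hg
  have hPA : N • (P * A) = -f • (1 : Matrix ι ι R[X]) := pfAdj_mul_self e k₀ hAt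
  -- `f' ∼ tr(P Z)` and `g' = tr(adj(A) Z)`, while `f adj(A) = -N g P` by the Laplace expansion.
  have hode : f * derivative g = 2 * g * derivative f := by
    have h1 : derivative f = -(Fintype.card κ : R[X]) * (P * Z).trace := by
      have hPt : Pᵀ = -P := pfAdj_transpose e k₀ A
      rw [hf, derivative_pfSum e k₀, pfDeriv_eq_sum_pfAdj, hAd, nsmul_eq_mul, neg_mul, ← mul_neg,
        ← trace_neg, ← Matrix.neg_mul, ← hPt, trace]
      simp only [diag_apply, mul_apply, transpose_apply]
      rw [Finset.sum_comm]
      simp only [mul_comm, hP]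
    have h2 : (N * g) • P = -f • A.adjugate := by
      have := congrArg (· * A.adjugate) hPA
      simpa [Matrix.mul_assoc, mul_adjugate, smul_smul] using this
    have h3 : f * (A.adjugate * Z).trace = -(N * g) * (P * Z).trace := by
      have := congrArg (fun M => (M * Z).trace) h2
      simp only [smul_mul, trace_smul, smul_eq_mul] at this
      linear_combination this
    rw [hg, derivative_det, hAd, h3, h1, hN]
    ring
  have hg0 : g.coeff 0 = (stdSkew e).det := by
    rw [coeff_zero_eq_eval_zero, ← coe_evalRingHom, hg, RingHom.map_det, RingHom.mapMatrix_apply,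
      hA0, hJ]
    exact ((Int.castRingHom R).map_det (stdSkew e)).symm
  have hf0 : f.coeff 0 = pfSum e (stdSkew e) := by
    rw [coeff_zero_eq_eval_zero, ← coe_evalRingHom, hf, map_pfSum, hA0, hJ, ← map_pfSum]
    rfl
  have hgz : g.coeff 0 ∈ nonZeroDivisors R := by
    rw [hg0, mem_nonZeroDivisors_iff_right]
    intro x hx
    rw [mul_comm, ← zsmul_eq_mul] at hx
    exact (IsAddTorsionFree.zsmul_eq_zero_iff_right (det_stdSkew_ne_zero e k₀)).1 hx
  -- `d f ^ 2 - c ^ 2 g` solves the same equation as `g` and vanishes at `X = 0`, where `f = c`, `g = d`.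
  have hsq : d * f ^ 2 = c ^ 2 * g := by
    rw [← sub_eq_zero]
    apply eq_zero_of_derivative_mul_eq (g := g) _ _ hgz
    · simp only [derivative_sub, derivative_mul, hd, hc, derivative_intCast, derivative_pow]
      simp only [map_ofNat, Nat.cast_ofNat, Nat.add_one_sub_one, pow_one]
      linear_combination -(((stdSkew e).det : R[X]) * f) * hode
    · rw [coeff_zero_eq_eval_zero] at *
      simp only [hd, hc, eval_sub, eval_mul, eval_pow, hf0, hg0, eval_intCast]
      ring
  have hch : aeval A A.charpoly.divX.divX * A ^ 2 = -g • (1 : Matrix ι ι R[X]) := by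
    have heven : Even (Fintype.card ι) := by
      rw [← Fintype.card_congr e, Fintype.card_prod, Fintype.card_fin]
      exact even_two.mul_left _
    have h0 : A.charpoly.coeff 0 = g := by
      rw [hg, det_eq_sign_charpoly_coeff, heven.neg_one_pow, one_mul]
    have h1 : A.charpoly.divX.coeff 0 = 0 := by
      rw [coeff_divX]; exact charpoly_coeff_one_of_skew hAt heven
    have h2 := aeval_self_charpoly A
    rw [← divX_mul_X_add A.charpoly, ← divX_mul_X_add A.charpoly.divX, h0, h1] at h2
    simp only [map_zero, add_zero, map_add, map_mul, aeval_X, aeval_C] at h2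
    rw [pow_two, ← mul_assoc, eq_neg_of_add_eq_zero_left h2, Algebra.algebraMap_eq_smul_one,
      neg_smul]
  have hPP : N ^ 2 • (P ^ 2 * A ^ 2) = f ^ 2 • (1 : Matrix ι ι R[X]) := by
    calc N ^ 2 • (P ^ 2 * A ^ 2) = N • (P * (N • (P * A)) * A) := by
          simp only [pow_two, mul_smul, mul_smul_comm, smul_mul_assoc, mul_assoc]
      _ = -f • (N • (P * A)) := by
          rw [hPA]
          simp only [mul_smul_comm, smul_mul_assoc, mul_one]
          rw [smul_comm, hPA]
      _ = _ := by rw [hPA, smul_smul]; congr 1; ring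
  -- Multiplying by `A ^ 2` gives `d f ^ 2 - c ^ 2 g = 0`, and `det A` can be cancelled.
  have hcancel : (d * N ^ 2) • P ^ 2 + (c ^ 2) • aeval A A.charpoly.divX.divX = 0 := by
    set M := (d * N ^ 2) • P ^ 2 + (c ^ 2) • aeval A A.charpoly.divX.divX
    have h1 : M * A ^ 2 = 0 := by
      rw [add_mul, smul_mul_assoc, smul_mul_assoc, hch, mul_smul, hPP, smul_smul, smul_smul,
        ← add_smul, hsq]
      simp
    have h2 : g ^ 2 • M = 0 := by
      have : A ^ 2 * A.adjugate ^ 2 = g ^ 2 • (1 : Matrix ι ι R[X]) := by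
        rw [pow_two, pow_two, mul_assoc, ← mul_assoc A A.adjugate, mul_adjugate, smul_mul_assoc,
          one_mul, mul_smul_comm, mul_adjugate, smul_smul, pow_two]
      have h3 := congrArg (· * A.adjugate ^ 2) h1
      simpa only [mul_assoc, this, mul_smul_comm, mul_one, zero_mul] using h3
    ext1 i j
    have h3 := congrFun (congrFun h2 i) j
    rw [Matrix.smul_apply, smul_eq_mul, mul_comm] at h3
    exact mem_nonZeroDivisors_iff_right.1
      (pow_mem (mem_nonzeroDivisors_of_coeff_mem 0 hgz) 2) _ h3
  -- The line passes through `Y` at `X = 1`.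
  have h1 := congrArg (evalRingHom (1 : R)).mapMatrix hcancel
  have hq : (evalRingHom (1 : R)).mapMatrix (aeval A A.charpoly.divX.divX) =
      aeval Y Y.charpoly.divX.divX := by
    have hdivX : ∀ p : R[X][X], p.divX.map (evalRingHom (1 : R)) =
        (p.map (evalRingHom (1 : R))).divX := by
      intro p; ext; simp
    have halg : (algebraMap R (Matrix ι ι R)).comp (evalRingHom (1 : R)) =
        (evalRingHom (1 : R)).mapMatrix.comp (algebraMap R[X] (Matrix ι ι R[X])) := by
      refine RingHom.ext fun p => ?_
      ext i j
      rcases eq_or_ne i j with rfl | h <;> simp [Matrix.algebraMap_matrix_apply, *]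
    rw [Polynomial.map_aeval_eq_aeval_map halg, hdivX, hdivX, ← charpoly_map,
      RingHom.mapMatrix_apply, hA1]
  have hsm : ∀ (a : R[X]) (M : Matrix ι ι R[X]), (evalRingHom (1 : R)).mapMatrix (a • M) =
      a.eval 1 • (evalRingHom (1 : R)).mapMatrix M := by
    intro a M; ext; simp
  rw [map_add, hsm, hsm, hq, map_pow, map_zero, RingHom.mapMatrix_apply, hP, ← pfAdj_map, hA1] at h1
  have h2 := eq_neg_of_add_eq_zero_left h1
  simpa [hc, hd, hN, neg_smul] using h2

/-- If all traces of powers of `Y` vanish, the characteristic polynomial is a power of `X`, and the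
square of the Pfaffian adjugate is a rational multiple of a power of `Y`. -/
lemma pfAdj_sq_of_trace_pow_eq_zero [IsAddTorsionFree R] (e : κ × Fin 2 ≃ ι) (k₀ : κ)
    {Y : Matrix ι ι R} (hY : Yᵀ = -Y) (htr : ∀ k, 0 < k → (Y ^ k).trace = 0) :
    (((stdSkew e).det : R) * (2 * Fintype.card κ) ^ 2) • pfAdj e k₀ Y ^ 2 =
      -(((pfSum e (stdSkew e) : ℤ) : R) ^ 2) • Y ^ (Fintype.card ι - 2) := by
  have hcard : 2 ≤ Fintype.card ι := by
    rw [← Fintype.card_congr e, Fintype.card_prod, Fintype.card_fin]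
    have : 0 < Fintype.card κ := Fintype.card_pos_iff.2 ⟨k₀⟩
    omega
  rw [pfAdj_sq e k₀ hY, charpoly_eq_X_pow_of_trace_pow_eq_zero htr, divX_X_pow,
    if_neg (by omega), divX_X_pow]
  rcases hcard.eq_or_lt with h | h
  · simp [← h]
  · rw [if_neg (by omega), map_pow, aeval_X, Nat.sub_sub]

end Pfaffian

/-! ### Pulling forms back to a Grassmann algebra -/

section Forms

open Matrix ExteriorAlgebra

variable {n m k : ℕ}

/-- The Grassmann algebra on `m` anticommuting generators. -/
abbrev Gr (m : ℕ) : Type := ExteriorAlgebra ℂ (Fin m → ℂ)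

/-- The product `θ_{f 0} ⋯ θ_{f (k - 1)}` of generators. -/
def mono (f : Fin k → Fin m) : Gr m := ιMulti ℂ k fun i => Pi.single (f i) 1

/-- The sum of `G(w_{f 0}, …, w_{f (k - 1)}) θ_{f 0} ⋯ θ_{f (k - 1)}` over all `f`, that is, `k!`
times the pullback of the form `G` to the generic odd vector `∑ a, θ_a w_a`. -/
def rawHat (w : Fin m → symMat n) (G : Form n k ℂ) : Gr m :=
  ∑ f : Fin k → Fin m, G (w ∘ f) • mono f

/-- The pullback of the form `G` to the generic odd vector `∑ a, θ_a w_a`. It turns wedge products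
into products, and it is defined for arbitrary functions `G`, of which it only sees the alternating
part. -/
def hat (w : Fin m → symMat n) (G : Form n k ℂ) : Gr m := (1 / (k ! : ℂ)) • rawHat w G

/-- The pullback `hat` applied to the entries of a matrix valued form. -/
def hatMat (w : Fin m → symMat n) (G : Form n k (Mat n)) :
    Matrix (Fin (2 * n)) (Fin (2 * n)) (Gr m) :=
  of fun i j => hat w fun v => G v i j

lemma mono_perm (f : Fin k → Fin m) (σ : Equiv.Perm (Fin k)) :
    mono (f ∘ σ) = ((Equiv.Perm.sign σ : ℤ) : ℂ) • mono f := by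
  rw [mono, show (fun i => Pi.single ((f ∘ σ) i) (1 : ℂ)) =
      (fun i => Pi.single (M := fun _ : Fin m => ℂ) (f i) (1 : ℂ)) ∘ σ from rfl,
    AlternatingMap.map_perm, Int.cast_smul_eq_zsmul]
  rfl

lemma mono_append {h : ℕ} (f : Fin h → Fin m) (g : Fin k → Fin m) :
    mono (Fin.append f g) = mono f * mono g := by
  rw [mono, mono, mono, ιMulti_mul_ιMulti]
  congr 1
  ext i : 1
  refine Fin.addCases (fun i => ?_) (fun i => ?_) i <;> simp

lemma rawHat_tensor {h : ℕ} (w : Fin m → symMat n) (G : Form n h ℂ) (H : Form n k ℂ) :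
    rawHat w (fun v : Fin (h + k) → symMat n =>
      G (fun i => v (Fin.castAdd k i)) * H (fun i => v (Fin.natAdd h i))) =
      rawHat w G * rawHat w H := by
  unfold rawHat
  rw [Finset.sum_mul_sum, ← Fintype.sum_prod_type', ← (Fin.appendEquiv h k).sum_comp]
  refine Finset.sum_congr rfl fun p _ => ?_
  have hf : Fin.appendEquiv h k p = Fin.append p.1 p.2 := rfl
  rw [smul_mul_smul_comm, ← mono_append, hf]
  simp only [Function.comp_def, Fin.append_left, Fin.append_right]

lemma rawHat_antisymm (w : Fin m → symMat n) (G : Form n k ℂ) :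
    rawHat w (fun v => ∑ σ : Equiv.Perm (Fin k), ((Equiv.Perm.sign σ : ℤ) : ℂ) • G (v ∘ σ)) =
      (k ! : ℂ) • rawHat w G := by
  unfold rawHat
  simp only [Finset.sum_smul]
  rw [Finset.sum_comm]
  have : ∀ σ : Equiv.Perm (Fin k), ∑ f : Fin k → Fin m,
      (((Equiv.Perm.sign σ : ℤ) : ℂ) • G ((w ∘ f) ∘ σ)) • mono f = rawHat w G := by
    intro σ
    unfold rawHat
    conv_rhs => rw [← (Equiv.arrowCongr σ.symm (Equiv.refl (Fin m))).sum_comp]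
    refine Finset.sum_congr rfl fun f _ => ?_
    rw [show Equiv.arrowCongr σ.symm (Equiv.refl (Fin m)) f = f ∘ σ from rfl, mono_perm, smul_assoc,
      smul_comm, Function.comp_assoc]
  rw [Finset.sum_congr rfl fun σ _ => this σ]
  simp [Fintype.card_perm, rawHat, Nat.cast_smul_eq_nsmul]

lemma rawHat_sum {ι : Type*} (s : Finset ι) (w : Fin m → symMat n) (G : ι → Form n k ℂ) :
    rawHat w (fun v => ∑ i ∈ s, G i v) = ∑ i ∈ s, rawHat w (G i) := by
  simp only [rawHat, Finset.sum_smul]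
  rw [Finset.sum_comm]

lemma rawHat_smul (c : ℂ) (w : Fin m → symMat n) (G : Form n k ℂ) :
    rawHat w (fun v => c * G v) = c • rawHat w G := by
  simp only [rawHat, Finset.smul_sum, mul_smul]

lemma hat_sum {ι : Type*} (s : Finset ι) (w : Fin m → symMat n) (G : ι → Form n k ℂ) :
    hat w (fun v => ∑ i ∈ s, G i v) = ∑ i ∈ s, hat w (G i) := by
  simp only [hat, rawHat_sum, Finset.smul_sum]

lemma hat_add (w : Fin m → symMat n) (G H : Form n k ℂ) :
    hat w (fun v => G v + H v) = hat w G + hat w H := by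
  simp only [hat, rawHat, add_smul, Finset.sum_add_distrib, smul_add]

lemma hat_smul (c : ℂ) (w : Fin m → symMat n) (G : Form n k ℂ) :
    hat w (fun v => c * G v) = c • hat w G := by
  simp only [hat, rawHat_smul, smul_comm c]

lemma hat_wedge {h : ℕ} (w : Fin m → symMat n) (G : Form n h ℂ) (H : Form n k ℂ) :
    hat w (wedge G H) = hat w G * hat w H := by
  have h1 := rawHat_antisymm w (fun v : Fin (h + k) → symMat n =>
      G (fun i => v (Fin.castAdd k i)) * H (fun i => v (Fin.natAdd h i)))
  -- `wedge` is an antisymmetrization, so its pullback only sees the product before antisymmetrizing.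
  have h2 : hat w (wedge G H) = (1 / ((h ! : ℂ) * (k ! : ℂ))) • hat w _ := hat_smul _ w _
  rw [h2, hat]
  erw [h1]
  rw [rawHat_tensor, hat, hat, smul_mul_smul_comm, smul_smul, smul_smul]
  congr 1
  have : ((h + k)! : ℂ) ≠ 0 := by exact_mod_cast (h + k).factorial_ne_zero
  field_simp

lemma hatMat_wedge {h : ℕ} (w : Fin m → symMat n) (G : Form n h (Mat n)) (H : Form n k (Mat n)) :
    hatMat w (wedge G H) = hatMat w G * hatMat w H := by
  ext i j
  have : (fun v => wedge G H v i j) =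
      fun v => ∑ l, wedge (fun v => G v i l) (fun v => H v l j) v := by
    ext v
    simp only [wedge, Matrix.smul_apply, Matrix.sum_apply, mul_apply, Finset.smul_sum]
    rw [Finset.sum_comm]
  rw [hatMat, of_apply, this, hat_sum, mul_apply]
  simp only [hat_wedge]
  rfl

lemma hat_trForm (w : Fin m → symMat n) (G : Form n k (Mat n)) :
    hat w (trForm G) = (hatMat w G).trace := by
  rw [show trForm G = fun v => ∑ i, G v i i from rfl, hat_sum]
  rfl

lemma hat_castDeg {a b : ℕ} (e : a = b) (w : Fin m → symMat n) (G : Form n a ℂ) :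
    hat w (castDeg e G) = hat w G := by
  subst e; rfl

/-- `G` is alternating in the weak sense that permuting its arguments multiplies it by the sign. Over
`ℂ` this is all that is needed to recover `G` from its pullbacks. -/
def IsAlt {R : Type} [AddCommGroup R] [Module ℂ R] (G : Form n k R) : Prop :=
  ∀ v (σ : Equiv.Perm (Fin k)), G (v ∘ σ) = ((Equiv.Perm.sign σ : ℤ) : ℂ) • G v

lemma isAlt_wedge {R : Type} [Ring R] [Algebra ℂ R] {h : ℕ} (G : Form n h R) (H : Form n k R) :
    IsAlt (wedge G H) := by
  intro v τ
  unfold wedge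
  rw [smul_comm]
  congr 1
  conv_rhs => rw [← Equiv.sum_comp (Equiv.mulLeft τ)]
  rw [Finset.smul_sum]
  refine Finset.sum_congr rfl fun σ _ => ?_
  rw [smul_smul]
  congr 1
  rcases Int.units_eq_one_or (Equiv.Perm.sign τ) with h | h <;> simp [h]

/-- The determinant, as an alternating map, does not vanish on the standard basis. -/
lemma mono_id_ne_zero : mono (id : Fin m → Fin m) ≠ 0 := by
  intro h
  have h1 := congrArg (liftAlternating (R := ℂ) (N := ℂ)
    (Pi.single m (Matrix.detRowAlternating (R := ℂ) (n := Fin m)))) h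
  rw [mono, liftAlternating_apply_ιMulti, map_zero, Pi.single_eq_same] at h1
  change Matrix.det (fun i : Fin m => (Pi.single (M := fun _ : Fin m => ℂ) i 1 : Fin m → ℂ)) = 0
    at h1
  have h2 : (fun i : Fin m => (Pi.single (M := fun _ : Fin m => ℂ) i 1 : Fin m → ℂ)) =
      (1 : Matrix (Fin m) (Fin m) ℂ) := by
    ext i j; simp [Matrix.one_apply, Pi.single_apply, eq_comm]
  rw [h2, det_one] at h1
  exact one_ne_zero h1

/-- In top degree the pullback is the value at `w` times the product of all generators. -/
lemma hat_top (w : Fin m → symMat n) {G : Form n m ℂ} (hG : IsAlt G) :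
    hat w G = G w • mono id := by
  have : rawHat w G = (m ! : ℂ) • (G w • mono id) := by
    unfold rawHat
    rw [Fintype.sum_eq_sum_perm fun f hf => ?_]
    · have : ∀ σ : Equiv.Perm (Fin m), G (w ∘ σ) • mono (σ : Fin m → Fin m) = G w • mono id := by
        intro σ
        have h1 : mono (σ : Fin m → Fin m) = _ := mono_perm id σ
        rw [h1, hG w σ]
        rcases Int.units_eq_one_or (Equiv.Perm.sign σ) with h | h <;> simp [h]
      rw [Finset.sum_congr rfl fun σ _ => this σ]
      simp [Fintype.card_perm, Nat.cast_smul_eq_nsmul]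
    · rw [mono, ιMulti_eq_zero_of_not_inj, smul_zero]
      intro hinj
      refine hf (Finite.injective_iff_bijective.1 fun a b hab => hinj ?_)
      simp [hab]
  rw [hat, this, smul_smul, one_div_mul_cancel (by exact_mod_cast m.factorial_ne_zero), one_smul]

lemma eq_of_hat_eq {G H : Form n m ℂ} (hG : IsAlt G) (hH : IsAlt H)
    (h : ∀ w : Fin m → symMat n, hat w G = hat w H) : G = H := by
  ext w
  have := h w
  rw [hat_top w hG, hat_top w hH] at this
  exact smul_left_injective ℂ mono_id_ne_zero this

/-! ### The generic symmetric matrix with odd entries -/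

lemma mono_one (f : Fin 1 → Fin m) : mono f = ι ℂ (Pi.single (f 0) 1) := by
  rw [mono, ιMulti_succ_apply, ιMulti_zero_apply, mul_one]

lemma sum_smul_ι_single (c : Fin m → ℂ) : ∑ a, c a • ι ℂ (Pi.single a 1 : Fin m → ℂ) = ι ℂ c := by
  simp only [← map_smul, ← map_sum]
  congr 1
  ext a
  simp [Finset.sum_apply, Pi.single_apply]

lemma hatMat_inclX (w : Fin m → symMat n) (i j : Fin (2 * n)) :
    hatMat w (inclX n) i j = ι ℂ (fun a => (w a : Mat n) i j) := by
  rw [← sum_smul_ι_single, hatMat, of_apply, hat, rawHat,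
    ← (Equiv.funUnique (Fin 1) (Fin m)).symm.sum_comp]
  simp [mono_one, inclX]

lemma hatMat_powX (w : Fin m → symMat n) (k : ℕ) :
    hatMat w (powX n k) = hatMat w (inclX n) ^ k := by
  induction k with
  | zero =>
    ext i j
    rw [hatMat, of_apply, hat, rawHat, Fintype.sum_unique, mono, ιMulti_zero_apply]
    rcases eq_or_ne i j with rfl | h <;> simp [powX, *]
  | succ k ih => rw [powX, hatMat_wedge, ih, pow_succ]

lemma ι_mul_ι_mem_center (x y : Fin m → ℂ) : ι ℂ x * ι ℂ y ∈ Subalgebra.center ℂ (Gr m) := by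
  rw [Subalgebra.mem_center_iff]
  intro z
  induction z using ExteriorAlgebra.induction with
  | algebraMap r => exact Algebra.commutes r _
  | ι z =>
    have h1 := eq_neg_of_add_eq_zero_left (ι_add_mul_swap (R := ℂ) z x)
    have h2 := eq_neg_of_add_eq_zero_left (ι_add_mul_swap (R := ℂ) z y)
    rw [← mul_assoc, h1, neg_mul, mul_assoc (ι ℂ x), h2, mul_neg, neg_neg, mul_assoc]
  | mul a b ha hb => rw [mul_assoc, hb, ← mul_assoc, ha, mul_assoc]
  | add a b ha hb => rw [add_mul, mul_add, ha, hb]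

/-- The square of the generic matrix. Its entries are even, hence central, so that it is a matrix over
a commutative ring. -/
def sqX (w : Fin m → symMat n) :
    Matrix (Fin (2 * n)) (Fin (2 * n)) (Subalgebra.center ℂ (Gr m)) :=
  of fun i j => ⟨(hatMat w (inclX n) ^ 2) i j, by
    rw [pow_two, mul_apply]
    refine Subalgebra.sum_mem _ fun l _ => ?_
    rw [hatMat_inclX, hatMat_inclX]
    exact ι_mul_ι_mem_center _ _⟩

/-- The inclusion of the center of the Grassmann algebra. -/
abbrev cval (m : ℕ) : Subalgebra.center ℂ (Gr m) →+* Gr m :=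
  (Subalgebra.center ℂ (Gr m)).val.toRingHom

lemma sqX_map (w : Fin m → symMat n) : (sqX w).map (cval m) = hatMat w (inclX n) ^ 2 := rfl

lemma sqX_pow_map (w : Fin m → symMat n) (k : ℕ) :
    (sqX w ^ k).map (cval m) = hatMat w (inclX n) ^ (2 * k) := by
  rw [pow_mul, ← sqX_map]
  exact map_pow (cval m).mapMatrix (sqX w) k

lemma hatMat_inclX_symm (w : Fin m → symMat n) (i j : Fin (2 * n)) :
    hatMat w (inclX n) i j = hatMat w (inclX n) j i := by
  rw [hatMat_inclX, hatMat_inclX]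
  congr 1
  ext a
  exact congrFun (congrFun (w a).2 j) i

lemma hatMat_inclX_anticomm (w : Fin m → symMat n) (i j k l : Fin (2 * n)) :
    hatMat w (inclX n) i j * hatMat w (inclX n) k l =
      -(hatMat w (inclX n) k l * hatMat w (inclX n) i j) := by
  simp only [hatMat_inclX]
  exact eq_neg_of_add_eq_zero_left (ι_add_mul_swap (R := ℂ) _ _)

lemma sqX_transpose (w : Fin m → symMat n) : (sqX w)ᵀ = -sqX w := by
  ext i j
  change (hatMat w (inclX n) ^ 2) j i = -(hatMat w (inclX n) ^ 2) i j
  rw [pow_two, mul_apply, mul_apply, ← Finset.sum_neg_distrib]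
  refine Finset.sum_congr rfl fun l _ => ?_
  rw [hatMat_inclX_anticomm, hatMat_inclX_symm w l i, hatMat_inclX_symm w j l]

lemma isAddTorsionFree_of_complexModule (V : Type*) [AddCommGroup V] [Module ℂ V] :
    IsAddTorsionFree V where
  nsmul_right_injective n hn p q h := by
    simp only [← Nat.cast_smul_eq_nsmul ℂ] at h
    exact smul_right_injective V (Nat.cast_ne_zero.2 hn) h

/-- The even powers of the generic matrix `x` have trace zero: moving the first of the `2k` odd
factors to the end changes the sign. -/
lemma trace_sqX_pow (w : Fin m → symMat n) (k : ℕ) (hk : 0 < k) : (sqX w ^ k).trace = 0 := by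
  obtain ⟨k, rfl⟩ : ∃ k', k = k' + 1 := ⟨k - 1, by omega⟩
  set x := hatMat w (inclX n) with hx
  set Z := (sqX w ^ k).map (cval m) with hZ
  have hZx : Z = x ^ (2 * k) := sqX_pow_map w k
  have hZc : ∀ i j y, y * Z i j = Z i j * y := fun i j y =>
    Subalgebra.mem_center_iff.1 ((sqX w ^ k) i j).2 y
  have h1 : cval m (sqX w ^ (k + 1)).trace = (x * (x * Z)).trace := by
    rw [AddMonoidHom.map_trace (cval m), sqX_pow_map, hZx, ← pow_succ', ← pow_succ']
    rfl
  -- The entries of `x` anticommute, and those of `Z` are central.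
  have h2 : (x * (x * Z)).trace = -(x * Z * x).trace := by
    simp only [trace, diag_apply, mul_apply, Finset.mul_sum, Finset.sum_mul]
    rw [Finset.sum_comm, ← Finset.sum_neg_distrib]
    refine Finset.sum_congr rfl fun i _ => ?_
    rw [← Finset.sum_neg_distrib]
    refine Finset.sum_congr rfl fun l _ => ?_
    rw [← Finset.sum_neg_distrib]
    refine Finset.sum_congr rfl fun p _ => ?_
    rw [← mul_assoc, hatMat_inclX_anticomm, neg_mul, mul_assoc, mul_assoc, hZc]
  have h3 : x * Z * x = x * (x * Z) := by
    rw [hZx, ← pow_succ', ← pow_succ', ← pow_succ]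
  rw [h3] at h2
  have := isAddTorsionFree_of_complexModule (Gr m)
  have h4 : (x * (x * Z)).trace = 0 := self_eq_neg.1 h2
  rw [h4] at h1
  exact Subtype.ext h1

/-! ### The covariant `Ω` and its relative differential -/

/-- The partition of the indices `0, …, 2n - 1` into the pairs `{2j, 2j + 1}`. -/
def pairEquiv (n : ℕ) : Fin n × Fin 2 ≃ Fin (2 * n) :=
  finProdFinEquiv.trans (finCongr (mul_comm n 2))

lemma pairEquiv_zero (j : Fin n) : pairEquiv n (j, 0) = ⟨2 * j.val, by omega⟩ := by
  ext; simp [pairEquiv]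

lemma pairEquiv_one (j : Fin n) : pairEquiv n (j, 1) = ⟨2 * j.val + 1, by omega⟩ := by
  ext; simp [pairEquiv]; omega

lemma pfaffianPolar_eq (Y : Fin n → Mat n) :
    pfaffianPolar Y = (1 / ((2 : ℂ) ^ n * (n ! : ℂ))) * pfPolar (pairEquiv n) Y := by
  simp [pfaffianPolar, pfPolar, pairEquiv_zero, pairEquiv_one]

lemma wedge_inclX_inclX (v : Fin 2 → symMat n) :
    wedge (inclX n) (inclX n) v = ⁅(v 0 : Mat n), (v 1 : Mat n)⁆ := by
  have h : (Finset.univ : Finset (Equiv.Perm (Fin 2))) = {1, Equiv.swap 0 1} := by decide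
  unfold wedge
  change _ • ∑ σ : Equiv.Perm (Fin 2), _ = _
  rw [h, Finset.sum_pair (by decide)]
  simp [inclX, Ring.lie_def, sub_eq_add_neg]

lemma rawHat_bracket (w : Fin m → symMat n) (a b : Fin (2 * n)) :
    rawHat w (fun v : Fin 2 → symMat n => (⁅(v 0 : Mat n), (v 1 : Mat n)⁆ : Mat n) a b) =
      cval m (2 * sqX w a b) := by
  have h : hatMat w (wedge (inclX n) (inclX n)) a b = cval m (sqX w a b) := by
    rw [hatMat_wedge, ← pow_two]; rfl
  rw [hatMat, of_apply, hat, show (1 + 1)! = 2 from rfl] at h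
  simp only [wedge_inclX_inclX] at h
  have h2 : ∀ r : Gr m, r = (1 / ((2 : ℕ) : ℂ)) • (2 * r) := by
    intro r
    rw [two_mul, ← two_smul ℂ r, smul_smul]
    norm_num
  rw [map_mul, ← h, map_ofNat, mul_smul_comm]
  exact h2 _

lemma rawHat_prod_pairs (w : Fin m → symMat n) (N : ℕ) (c : Fin N → symMat n → symMat n → ℂ)
    (z : Fin N → Subalgebra.center ℂ (Gr m))
    (h : ∀ j, rawHat w (fun v : Fin 2 → symMat n => c j (v 0) (v 1)) = cval m (z j)) :
    rawHat w (fun v : Fin (2 * N) → symMat n =>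
      ∏ j : Fin N, c j (v ⟨2 * j.val, by omega⟩) (v ⟨2 * j.val + 1, by omega⟩)) =
      cval m (∏ j, z j) := by
  induction N with
  | zero =>
    have : Unique (Fin (2 * 0) → Fin m) := inferInstanceAs (Unique (Fin 0 → Fin m))
    rw [rawHat, Fintype.sum_unique]
    simp only [Finset.univ_eq_empty, Finset.prod_empty, one_smul, map_one]
    exact ιMulti_zero_apply _
  | succ N ih =>
    rw [Fin.prod_univ_castSucc, map_mul, ← ih (fun j => c j.castSucc) _ fun j => h j.castSucc,
      ← h (Fin.last N), ← rawHat_tensor]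
    congr 1
    ext v
    rw [Fin.prod_univ_castSucc]
    rfl

lemma commQ_skew {N : ℕ} (X : Fin (2 * (N + 1) - 2) → symMat (N + 1)) {E : Mat (N + 1)}
    (hE : Eᵀ = -E) :
    commQ X E = (1 / ((2 : ℂ) ^ (N + 1) * ((N + 1)! : ℂ))) *
      ∑ σ : Equiv.Perm (Fin (2 * (N + 1))), ((Equiv.Perm.sign σ : ℤ) : ℂ) *
        ((∏ j : Fin N, (⁅(X ⟨2 * j.val, by omega⟩ : Mat (N + 1)),
            (X ⟨2 * j.val + 1, by omega⟩ : Mat (N + 1))⁆ : Mat (N + 1))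
          (σ (pairEquiv (N + 1) (j.castSucc, 0))) (σ (pairEquiv (N + 1) (j.castSucc, 1)))) *
        E (σ (pairEquiv (N + 1) (Fin.last N, 0))) (σ (pairEquiv (N + 1) (Fin.last N, 1)))) := by
  -- The matrices entering `Q` are already skew-symmetric.
  have hskew : ∀ M : Mat (N + 1), Mᵀ = -M → (1 / 2 : ℂ) • (M - Mᵀ) = M := by
    intro M hM
    rw [hM, sub_neg_eq_add, ← two_smul ℂ, smul_smul]
    norm_num
  have hbr : ∀ A B : symMat (N + 1), (⁅(A : Mat (N + 1)), (B : Mat (N + 1))⁆ : Mat (N + 1))ᵀ =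
      -⁅(A : Mat (N + 1)), (B : Mat (N + 1))⁆ := by
    intro A B
    have hA : (A : Mat (N + 1))ᵀ = A := A.2
    have hB : (B : Mat (N + 1))ᵀ = B := B.2
    rw [Ring.lie_def, transpose_sub, transpose_mul, transpose_mul, hA, hB, neg_sub]
  unfold commQ Q
  rw [pfaffianPolar_eq]
  congr 1
  unfold pfPolar
  refine Finset.sum_congr rfl fun σ _ => ?_
  rw [zsmul_eq_mul, Fin.prod_univ_castSucc]
  congr 2
  · refine Finset.prod_congr rfl fun j _ => ?_
    have hj : (j.castSucc : Fin (N + 1)).val + 1 < N + 1 := by simp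
    beta_reduce
    rw [dif_pos hj, hskew _ (hbr _ _)]
    rfl
  · beta_reduce
    rw [dif_neg (by simp), hskew _ hE]

lemma rawHat_commQ {N : ℕ} (w : Fin m → symMat (N + 1)) {E : Mat (N + 1)} (hE : Eᵀ = -E) :
    rawHat w (fun X => commQ X E) = (1 / (2 * ((N + 1)! : ℂ))) •
      cval m (pfDeriv (pairEquiv (N + 1)) (Fin.last N) (sqX w)
        (E.map (algebraMap ℂ (Subalgebra.center ℂ (Gr m))))) := by
  simp only [commQ_skew _ hE]
  rw [rawHat_smul, rawHat_sum]
  set e := pairEquiv (N + 1) with he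
  have hp : ∀ σ : Equiv.Perm (Fin (2 * (N + 1))),
      rawHat w (fun X : Fin (2 * (N + 1) - 2) → symMat (N + 1) =>
        ∏ j : Fin N, (⁅(X ⟨2 * j.val, by omega⟩ : Mat (N + 1)),
            (X ⟨2 * j.val + 1, by omega⟩ : Mat (N + 1))⁆ : Mat (N + 1))
          (σ (e (j.castSucc, 0))) (σ (e (j.castSucc, 1)))) =
      (2 : ℂ) ^ N • cval m (∏ j : Fin N, sqX w (σ (e (j.castSucc, 0))) (σ (e (j.castSucc, 1)))) := by
    intro σ
    have h := rawHat_prod_pairs w N (fun j A B => (⁅(A : Mat (N + 1)), (B : Mat (N + 1))⁆ :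
      Mat (N + 1)) (σ (e (j.castSucc, 0))) (σ (e (j.castSucc, 1)))) _
      fun j => rawHat_bracket w (σ (e (j.castSucc, 0))) (σ (e (j.castSucc, 1)))
    refine Eq.trans h ?_
    rw [Finset.prod_mul_distrib, Finset.prod_const, Finset.card_univ, Fintype.card_fin, map_mul,
      map_pow, map_ofNat, Algebra.smul_def, map_pow, map_ofNat]
  rw [pfDeriv, pfPolar, map_sum, Finset.smul_sum, Finset.smul_sum]
  refine Finset.sum_congr rfl fun σ _ => ?_
  rw [Fin.prod_univ_castSucc, Function.update_self, rawHat_smul]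
  simp only [mul_comm _ (E _ _)]
  rw [rawHat_smul, hp, smul_smul, smul_smul, smul_smul]
  erw [map_zsmul]
  rw [map_mul]
  have h1 : ∀ j : Fin N, Function.update (fun _ => sqX w) (Fin.last N)
      (E.map (algebraMap ℂ (Subalgebra.center ℂ (Gr m)))) j.castSucc = sqX w := by
    intro j
    rw [Function.update_of_ne (Fin.castSucc_lt_last j).ne]
  simp only [h1]
  rw [map_apply, show cval m (algebraMap ℂ (Subalgebra.center ℂ (Gr m)) _) =
    algebraMap ℂ (Gr m) _ from rfl, ← Algebra.commutes, ← Algebra.smul_def,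
    ← Int.cast_smul_eq_zsmul ℂ, smul_smul, smul_smul]
  congr 1
  have : ((N + 1)! : ℂ) ≠ 0 := by exact_mod_cast Nat.factorial_ne_zero _
  field_simp
  ring

lemma commQ_neg {N : ℕ} (X : Fin (2 * (N + 1) - 2) → symMat (N + 1)) {E : Mat (N + 1)}
    (hE : Eᵀ = -E) : commQ X (-E) = -commQ X E := by
  rw [commQ_skew X hE, commQ_skew X (E := -E) (by rw [transpose_neg, hE]), ← mul_neg,
    ← Finset.sum_neg_distrib]
  simp only [Matrix.neg_apply, mul_neg]

lemma wedgeE_transpose (a b : Fin (2 * n)) : (wedgeE a b : Mat n)ᵀ = -wedgeE a b := by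
  simp [wedgeE, transpose_sub, transpose_single]

lemma wedgeE_swap (a b : Fin (2 * n)) : (wedgeE b a : Mat n) = -wedgeE a b := by
  simp [wedgeE]

lemma Omega_apply {N : ℕ} (X : Fin (2 * (N + 1) - 2) → symMat (N + 1)) (a b : Fin (2 * (N + 1))) :
    Omega (N + 1) X a b = ∑ σ : Equiv.Perm (Fin (2 * (N + 1) - 2)),
      ((Equiv.Perm.sign σ : ℤ) : ℂ) • commQ (X ∘ σ) (wedgeE a b) := by
  set F : Fin (2 * (N + 1)) → Fin (2 * (N + 1)) → ℂ := fun i j =>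
    ∑ σ : Equiv.Perm (Fin (2 * (N + 1) - 2)),
      ((Equiv.Perm.sign σ : ℤ) : ℂ) • commQ (X ∘ σ) (wedgeE i j) with hF
  have hanti : ∀ i j, F j i = -F i j := by
    intro i j
    simp only [hF]
    rw [← Finset.sum_neg_distrib]
    refine Finset.sum_congr rfl fun σ _ => ?_
    rw [wedgeE_swap, commQ_neg _ (wedgeE_transpose i j), smul_neg]
  -- `M` is the upper triangular half of the skew-symmetric matrix `Ω`.
  set M : Mat (N + 1) := of fun i j => if i < j then F i j else 0 with hM
  have hΩ : Omega (N + 1) X = M - Mᵀ := by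
    have hMt : Mᵀ = ∑ i, ∑ j, single j i (M i j) := by
      rw [matrix_eq_sum_single Mᵀ, Finset.sum_comm]
      rfl
    refine Eq.trans ?_ (congrArg₂ (· - ·) (matrix_eq_sum_single M) hMt).symm
    rw [← Finset.sum_sub_distrib]
    refine Finset.sum_congr rfl fun i _ => ?_
    rw [← Finset.sum_sub_distrib]
    refine Finset.sum_congr rfl fun j _ => ?_
    rw [hM, of_apply]
    split_ifs with hij
    · rw [← Finset.sum_smul, wedgeE, smul_sub, smul_single, smul_single, smul_eq_mul, mul_one]
      rfl
    · simp
  rw [hΩ, Matrix.sub_apply, transpose_apply, hM, of_apply, of_apply]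
  change _ = F a b
  rcases lt_trichotomy a b with h | h | h
  · simp [h, h.not_gt]
  · subst h
    have := self_eq_neg.1 (hanti a a)
    simp [this]
  · simp [h, h.not_gt, hanti b a]

/-- The pullback of the covariant `Ω` is, up to a factorial, the Pfaffian adjugate of the square of the
generic matrix. -/
lemma hatMat_Omega {N : ℕ} (w : Fin m → symMat (N + 1)) :
    hatMat w (Omega (N + 1)) = (1 / ((N + 1)! : ℂ)) •
      (pfAdj (pairEquiv (N + 1)) (Fin.last N) (sqX w)).map (cval m) := by
  ext a b
  have hE := wedgeE_transpose a b
  rw [hatMat, of_apply, hat]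
  simp only [Omega_apply]
  rw [rawHat_antisymm w (fun X => commQ X (wedgeE a b)), smul_smul, one_div_mul_cancel
    (by exact_mod_cast Nat.factorial_ne_zero _), one_smul, rawHat_commQ w hE]
  have h : (wedgeE a b : Mat (N + 1)).map (algebraMap ℂ (Subalgebra.center ℂ (Gr m))) =
      single a b 1 - (single a b 1)ᵀ := by
    rw [wedgeE, Matrix.map_sub _ (map_sub _), map_single, map_single, map_one, transpose_single]
  rw [h]
  erw [pfDeriv_sub_transpose]
  rw [map_mul, map_ofNat, Matrix.smul_apply, map_apply, pfAdj, of_apply]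
  have h2 : ∀ r : Gr m, (2 : Gr m) * r = (2 : ℂ) • r := fun r => by rw [two_mul, two_smul]
  rw [h2, smul_smul]
  congr 1
  field_simp

/-- Each of the `k + 1` terms contributes equally, because moving `θ` from the place `h` to the front
costs the sign `(-1) ^ h`. -/
lemma hat_sum_removeNth (w : Fin m → symMat n) (c : symMat n → ℂ) (G : Form n k ℂ) :
    hat w (fun X : Fin (k + 1) → symMat n =>
      ∑ h : Fin (k + 1), (-1 : ℂ) ^ (h.val + 1) * (c (X h) * G (Fin.removeNth h X))) =
      -(ι ℂ (fun a => c (w a)) * hat w G) := by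
  have key : ∀ h : Fin (k + 1), rawHat w (fun X : Fin (k + 1) → symMat n =>
      (-1 : ℂ) ^ (h.val + 1) * (c (X h) * G (Fin.removeNth h X))) =
      -(ι ℂ (fun a => c (w a)) * rawHat w G) := by
    intro h
    rw [rawHat, ← (Fin.insertNthEquiv (fun _ => Fin m) h).sum_comp, Fintype.sum_prod_type,
      ← sum_smul_ι_single, rawHat, Finset.sum_mul_sum, ← Finset.sum_neg_distrib]
    refine Finset.sum_congr rfl fun a _ => ?_
    rw [← Finset.sum_neg_distrib]
    refine Finset.sum_congr rfl fun g _ => ?_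
    have hm : mono (Fin.insertNth (α := fun _ => Fin m) h a g) =
        (-1 : ℂ) ^ h.val • (ι ℂ (Pi.single a 1 : Fin m → ℂ) * mono g) := by
      have h1 : (fun i => (Pi.single (Fin.insertNth (α := fun _ => Fin m) h a g i) 1 : Fin m → ℂ)) =
          Fin.insertNth (α := fun _ => Fin m → ℂ) h (Pi.single a 1) fun i => Pi.single (g i) 1 := by
        ext1 i
        refine Fin.succAboveCases h ?_ (fun i => ?_) i <;> simp
      rw [mono, h1, AlternatingMap.map_insertNth, ιMulti_succ_apply, ← Int.cast_smul_eq_zsmul ℂ]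
      simp [mono]
    have h2 : (w ∘ Fin.insertNth (α := fun _ => Fin m) h a g) h = w a := by simp
    have h3 : Fin.removeNth h (w ∘ Fin.insertNth (α := fun _ => Fin m) h a g) = w ∘ g := by
      ext1 i; simp [Fin.removeNth]
    change (_ * (c ((w ∘ Fin.insertNth (α := fun _ => Fin m) h a g) h) * G (Fin.removeNth h
      (w ∘ Fin.insertNth (α := fun _ => Fin m) h a g)))) •
      mono (Fin.insertNth (α := fun _ => Fin m) h a g) = _
    rw [h2, h3, hm, smul_smul, smul_mul_smul_comm, ← neg_smul]
    congr 1
    have : (-1 : ℂ) ^ h.val * (-1) ^ h.val = 1 := by rw [← mul_pow]; simp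
    rw [pow_succ]
    linear_combination (-(c (w a) * G (w ∘ g))) * this
  rw [hat_sum]
  simp only [hat, key]
  rw [Finset.sum_const, Finset.card_univ, Fintype.card_fin, smul_neg, smul_neg, mul_smul_comm,
    ← Nat.cast_smul_eq_nsmul ℂ, smul_smul]
  congr 2
  have : (k ! : ℂ) ≠ 0 := by exact_mod_cast Nat.factorial_ne_zero _
  have : (k + 1 : ℂ) ≠ 0 := by exact_mod_cast k.succ_ne_zero
  rw [Nat.factorial_succ]
  push_cast
  field_simp

/-- The commutator of two symmetric matrices is skew-symmetric, so its symmetric part vanishes. -/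
lemma bracketPart_eq_zero (ω : Form n k (Mat n)) (hω : ∀ v, (∃ i, v i = 0) → ω v = 0) :
    bracketPart ω = 0 := by
  cases k with
  | zero => rfl
  | succ k =>
    ext1 X
    refine Finset.sum_eq_zero fun j _ => Finset.sum_eq_zero fun i _ => ?_
    split_ifs
    · rw [hω, smul_zero]
      refine ⟨0, Subtype.ext ?_⟩
      have h : ∀ A : symMat n, (A : Mat n)ᵀ = A := fun A => A.2
      simp [symPart, Ring.lie_def, transpose_mul, h]
    · rfl

lemma Omega_eq_zero (v : Fin (2 * n - 2) → symMat n) (hv : ∃ i, v i = 0) : Omega n v = 0 := by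
  obtain ⟨i, hi⟩ := hv
  have hQ : ∀ (σ : Equiv.Perm (Fin (2 * n - 2))) E, commQ (fun a => v (σ a)) E = 0 := by
    intro σ E
    set p := σ.symm i with hp
    have hvp : v (σ p) = 0 := by rw [hp, Equiv.apply_symm_apply, hi]
    have hlt : p.val / 2 + 1 < n := by omega
    have hz : ⁅(v (σ ⟨2 * (p.val / 2), by omega⟩) : Mat n),
        (v (σ ⟨2 * (p.val / 2) + 1, by omega⟩) : Mat n)⁆ = 0 := by
      rcases Nat.mod_two_eq_zero_or_one p.val with h | h
      · have : (⟨2 * (p.val / 2), by omega⟩ : Fin (2 * n - 2)) = p := by ext; simp; omega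
        rw [this, hvp]; simp [Ring.lie_def]
      · have : (⟨2 * (p.val / 2) + 1, by omega⟩ : Fin (2 * n - 2)) = p := by ext; simp; omega
        rw [this, hvp]; simp [Ring.lie_def]
    unfold commQ Q
    rw [pfaffianPolar_eq, pfPolar, Finset.sum_eq_zero, mul_zero]
    intro τ _
    rw [Finset.prod_eq_zero (Finset.mem_univ (⟨p.val / 2, by omega⟩ : Fin n)), smul_zero]
    beta_reduce
    rw [dif_pos hlt, hz]
    simp
  unfold Omega
  refine Finset.sum_eq_zero fun a _ => Finset.sum_eq_zero fun b _ => ?_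
  simp [hQ]

lemma hatMat_relDiff (w : Fin m → symMat n) (ω : Form n k (Mat n)) (hω : bracketPart ω = 0)
    (hc : ∀ i j y, y * hatMat w ω i j = hatMat w ω i j * y) :
    hatMat w (relDiff ω) =
      -(hatMat w (inclX n) * hatMat w ω + hatMat w ω * hatMat w (inclX n)) := by
  ext i j
  have h : (fun X => relDiff ω X i j) = fun X : Fin (k + 1) → symMat n => ∑ l,
      ((∑ h : Fin (k + 1), (-1 : ℂ) ^ (h.val + 1) *
        ((X h : Mat n) i l * (fun v => ω v l j) (Fin.removeNth h X))) +
      ∑ h : Fin (k + 1), (-1 : ℂ) ^ (h.val + 1) *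
        ((X h : Mat n) j l * (fun v => ω v i l) (Fin.removeNth h X))) := by
    ext X
    have h0 : relDiff ω X = ∑ h : Fin (k + 1), (-1 : ℂ) ^ (h.val + 1) •
        act (X h : Mat n) (ω (Fin.removeNth h X)) := by
      rw [relDiff, hω]
      exact zero_add _
    simp only [h0, Matrix.sum_apply, Matrix.smul_apply, act, Matrix.add_apply, mul_apply,
      transpose_apply, smul_eq_mul]
    have hsw : ∀ F : Fin (2 * n) → Fin (k + 1) → ℂ, ∑ l, ∑ h, F l h = ∑ h, ∑ l, F l h :=
      fun F => Finset.sum_comm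
    rw [Finset.sum_add_distrib, hsw, hsw, ← Finset.sum_add_distrib]
    refine Finset.sum_congr rfl fun h _ => ?_
    rw [← Finset.mul_sum, ← Finset.mul_sum, ← mul_add]
    congr 2
    exact Finset.sum_congr rfl fun l _ => mul_comm _ _
  rw [hatMat, of_apply, h, hat_sum, Matrix.neg_apply, Matrix.add_apply, mul_apply, mul_apply,
    ← Finset.sum_add_distrib, ← Finset.sum_neg_distrib]
  refine Finset.sum_congr rfl fun l _ => (hat_add w _ _).trans ?_
  refine (congrArg₂ (· + ·) (hat_sum_removeNth w (fun A => (A : Mat n) i l) fun v => ω v l j)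
    (hat_sum_removeNth w (fun A => (A : Mat n) j l) fun v => ω v i l)).trans ?_
  rw [← hatMat_inclX, ← hatMat_inclX, neg_add, ← hc, hatMat_inclX_symm w l j]
  rfl

/-! ### The trace of `Ω ∧ dΩ` -/

lemma hat_trForm_Omega_wedge_relDiff {m N : ℕ} (w : Fin m → symMat (N + 1)) :
    hat w (trForm (wedge (Omega (N + 1)) (relDiff (Omega (N + 1))))) =
      -(2 : ℂ) • (hatMat w (Omega (N + 1)) ^ 2 * hatMat w (inclX (N + 1))).trace := by
  set P := hatMat w (Omega (N + 1)) with hP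
  set x := hatMat w (inclX (N + 1)) with hx
  have hc : ∀ i j y, y * P i j = P i j * y := by
    intro i j y
    rw [hP, hatMat_Omega, Matrix.smul_apply, mul_smul_comm, smul_mul_assoc]
    exact congrArg _ (Subalgebra.mem_center_iff.1 (pfAdj (pairEquiv (N + 1)) (Fin.last N)
      (sqX w) i j).2 y)
  have htr : ∀ M : Matrix (Fin (2 * (N + 1))) (Fin (2 * (N + 1))) (Gr m),
      (M * P).trace = (P * M).trace := by
    intro M
    simp only [trace, diag_apply, mul_apply]
    rw [Finset.sum_comm]
    exact Finset.sum_congr rfl fun i _ => Finset.sum_congr rfl fun j _ => hc _ _ _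
  rw [hat_trForm, hatMat_wedge, hatMat_relDiff w _ (bracketPart_eq_zero _ Omega_eq_zero) hc, ← hP,
    ← hx, Matrix.mul_neg, trace_neg, Matrix.mul_add, trace_add, ← Matrix.mul_assoc, htr,
    ← Matrix.mul_assoc, ← pow_two, neg_smul, two_smul]

/-- Up to a nonzero rational factor, the square of `Ω` is the power `X ^ (4n - 4)`. -/
lemma hatMat_Omega_sq {m N : ℕ} (w : Fin m → symMat (N + 1)) :
    (((stdSkew (pairEquiv (N + 1))).det : ℂ) * (2 * (N + 1 : ℂ)) ^ 2 * ((N + 1)! : ℂ) ^ 2) •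
        hatMat w (Omega (N + 1)) ^ 2 =
      -((pfSum (pairEquiv (N + 1)) (stdSkew (pairEquiv (N + 1))) : ℤ) : ℂ) ^ 2 •
        hatMat w (inclX (N + 1)) ^ (4 * N) := by
  have := isAddTorsionFree_of_complexModule (Subalgebra.center ℂ (Gr m))
  have h := congrArg (cval m).mapMatrix (pfAdj_sq_of_trace_pow_eq_zero (pairEquiv (N + 1))
    (Fin.last N) (sqX_transpose w) (trace_sqX_pow w))
  have hsm : ∀ (a : ℂ) (s : Subalgebra.center ℂ (Gr m)), cval m s = algebraMap ℂ (Gr m) a →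
      ∀ M : Matrix (Fin (2 * (N + 1))) (Fin (2 * (N + 1))) (Subalgebra.center ℂ (Gr m)),
      (cval m).mapMatrix (s • M) = a • (cval m).mapMatrix M := by
    intro a s hs M
    ext i j
    rw [Matrix.smul_apply, RingHom.mapMatrix_apply, RingHom.mapMatrix_apply, map_apply, map_apply,
      Matrix.smul_apply, smul_eq_mul, map_mul, hs, Algebra.smul_def]
  have hpow : (cval m).mapMatrix (sqX w ^ (Fintype.card (Fin (2 * (N + 1))) - 2)) =
      hatMat w (inclX (N + 1)) ^ (4 * N) := by
    refine (sqX_pow_map w _).trans (congrArg _ ?_)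
    rw [Fintype.card_fin]
    omega
  generalize (stdSkew (pairEquiv (N + 1))).det = d at h ⊢
  generalize pfSum (pairEquiv (N + 1)) (stdSkew (pairEquiv (N + 1))) = c at h ⊢
  rw [hsm ((d : ℂ) * (2 * (N + 1 : ℂ)) ^ 2) _ (by
      simp only [map_mul, map_pow, map_intCast, map_natCast, map_ofNat, map_add, map_one,
        Fintype.card_fin, Nat.cast_add, Nat.cast_one]),
    hsm (-(c : ℂ) ^ 2) _ (by
      change -(cval m ((c : Subalgebra.center ℂ (Gr m)) ^ 2)) = _
      simp only [map_neg, map_pow, map_intCast]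
      exact congrArg (fun y : Gr m => -y ^ 2) (map_intCast (cval m) c)), hpow, map_pow] at h
  rw [← h, hatMat_Omega, _root_.smul_pow, smul_smul]
  congr 1
  have : ((N + 1)! : ℂ) ≠ 0 := by exact_mod_cast Nat.factorial_ne_zero _
  field_simp

lemma isAlt_powX (n k : ℕ) : IsAlt (powX n k) := by
  cases k with
  | zero =>
    intro v σ
    rw [Subsingleton.elim σ 1]
    simp [powX]
  | succ k => exact isAlt_wedge _ _

lemma IsAlt.trForm {n k : ℕ} {G : Form n k (Mat n)} (hG : IsAlt G) : IsAlt (trForm G) := by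
  intro v σ
  rw [EvenOrthogonal.trForm, hG, trace_smul]
  rfl

lemma IsAlt.castDeg {n a b : ℕ} (e : a = b) {G : Form n a ℂ} (hG : IsAlt G) :
    IsAlt (castDeg e G) := by
  subst e; exact hG

lemma IsAlt.smul {n k : ℕ} {G : Form n k ℂ} (c : ℂ) (hG : IsAlt G) : IsAlt (c • G) := by
  intro v σ
  rw [Pi.smul_apply, Pi.smul_apply, hG, smul_comm]

/-- The identity holds without a decomposable remainder. -/
theorem exists_trForm_Omega_wedge_relDiff_eq (N : ℕ)
    (h : (2 * (N + 1) - 2) + (2 * (N + 1) - 2 + 1) = 4 * (N + 1) - 3) :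
    ∃ q : ℚ, q ≠ 0 ∧
      castDeg h (trForm (wedge (Omega (N + 1)) (relDiff (Omega (N + 1))))) =
        (q : ℂ) • trForm (powX (N + 1) (4 * (N + 1) - 3)) := by
  set e := pairEquiv (N + 1) with he
  have hd : ((stdSkew e).det : ℚ) ≠ 0 := Int.cast_ne_zero.2 (det_stdSkew_ne_zero e (Fin.last N))
  have hp : ((pfSum e (stdSkew e) : ℤ) : ℚ) ≠ 0 := Int.cast_ne_zero.2 (pfSum_stdSkew_pos e).ne'
  have hf : ((N + 1)! : ℚ) ≠ 0 := Nat.cast_ne_zero.2 (Nat.factorial_ne_zero _)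
  have hN : (N + 1 : ℚ) ≠ 0 := by exact_mod_cast N.succ_ne_zero
  have hsq := fun w : Fin (4 * (N + 1) - 3) → symMat (N + 1) => hatMat_Omega_sq w
  rw [← he] at hsq
  generalize (stdSkew e).det = d at hsq hd
  generalize pfSum e (stdSkew e) = c at hsq hp
  set D : ℚ := (d : ℚ) * (2 * (N + 1 : ℚ)) ^ 2 * ((N + 1)! : ℚ) ^ 2 with hD
  have hD0 : D ≠ 0 := by positivity
  refine ⟨2 * (c : ℚ) ^ 2 / D, by positivity, ?_⟩
  refine eq_of_hat_eq ((isAlt_wedge _ _).trForm.castDeg _) ((isAlt_powX _ _).trForm.smul _)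
    fun w => ?_
  have hDc : (D : ℂ) ≠ 0 := Rat.cast_ne_zero.2 hD0
  have hDeq : (d : ℂ) * (2 * (N + 1 : ℂ)) ^ 2 * ((N + 1)! : ℂ) ^ 2 = D := by
    rw [hD]; push_cast; rfl
  have hsq' : hatMat w (Omega (N + 1)) ^ 2 =
      (-(c : ℂ) ^ 2 / (D : ℂ)) • hatMat w (inclX (N + 1)) ^ (4 * N) := by
    rw [div_eq_inv_mul, mul_smul, ← hsq, hDeq, smul_smul, inv_mul_cancel₀ hDc, one_smul]
  have hpow : hatMat w (inclX (N + 1)) ^ (4 * (N + 1) - 3) =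
      hatMat w (inclX (N + 1)) ^ (4 * N) * hatMat w (inclX (N + 1)) := pow_succ _ (4 * N)
  rw [hat_castDeg, hat_trForm_Omega_wedge_relDiff, hsq',
    show hat w ((_ : ℂ) • trForm (powX (N + 1) (4 * (N + 1) - 3))) = _ from hat_smul _ w _,
    hat_trForm, hatMat_powX, hpow, Matrix.smul_mul, Matrix.trace_smul, smul_smul]
  congr 1
  push_cast
  ring

end Forms

end

end EvenOrthogonal

theorem mainTheorem2 (n : ℕ) (hn : 1 ≤ n) :
    ∃ q : ℚ, q ≠ 0 ∧
      ∃ R ∈ EvenOrthogonal.tracePolynomials n (4 * n - 3) (4 * n - 3),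
        EvenOrthogonal.castDeg
            (show (2 * n - 2) + (2 * n - 2 + 1) = 4 * n - 3 by omega)
            (EvenOrthogonal.trForm
              (EvenOrthogonal.wedge (EvenOrthogonal.Omega n)
                (EvenOrthogonal.relDiff (EvenOrthogonal.Omega n)))) =
          (q : ℂ) • EvenOrthogonal.trForm (EvenOrthogonal.powX n (4 * n - 3)) + R := by
  obtain ⟨N, rfl⟩ : ∃ N, n = N + 1 := ⟨n - 1, by omega⟩
  obtain ⟨q, hq, h⟩ := EvenOrthogonal.exists_trForm_Omega_wedge_relDiff_eq N (by omega)
  exact ⟨q, hq, 0, Submodule.zero_mem _, by rw [add_zero, h]⟩
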